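/- Let $k\ge 2$ and $n=2k$ (so $n\ge 4$ is even). Let $\mathcal B_n$ be the Brauer monoid: its elements are the set partitions of $\{1,\dots,n\}\cup\{1',\dots,n'\}$ into blocks of size $2$. To form $\alpha\beta$, identify each lower vertex $i'$ of $\alpha$ with the upper vertex $i$ of $\beta$; then $\alpha\beta$ records which of the remaining (outer) vertices are in the same connected component. The rank of $\alpha$ is its number of transversals, i.e. of blocks containing both an upper and a lower vertex, and $\alpha^*$ is $\alpha$ with dashed and undashed vertices interchanged. Put $I_r=\{\alpha\in\mathcal B_n:\operatorname{rank}\alpha\le r\}$, and let $p_r$ be the number of $\varepsilon\in\mathcal B_n$ of rank $r$ with $\varepsilon^2=\varepsilon=\varepsilon^*$. Write $\alpha\le_{\mathscr R}\beta$ if $\alpha\in\beta\mathcal B_n$, and let $R_\alpha=\{\beta:\alpha\le_{\mathscr R}\beta\le_{\mathscr R}\alpha\}$. Let $\zeta\in\mathcal B_n$ have blocks $\{2i-1,2i\}$ and $\{(2i-1)',(2i)'\}$ for $1\le i\le k$, and let $\gamma\in\mathcal B_n$ have blocks $\{1,1'\}$, $\{2,2'\}$, and $\{2i-1,2i\}$,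 $\{(2i-1)',(2i)'\}$ for $2\le i\le k$. Let $K=\{\alpha:\zeta\le_{\mathscr R}\alpha\}$, $J=I_2\cap K$, and $U=\{\alpha:\alpha\text{ is a unit of }\mathcal B_n\text{ and }\alpha\zeta=\zeta\}$. For $\alpha\in I_2$ let $\widehat\alpha$ be $\alpha$ if its rank is $0$, and otherwise the partition obtained from $\alpha$ by replacing its two transversals $\{a_1,b_1'\},\{a_2,b_2'\}$ by $\{a_1,a_2\}$ and $\{b_1',b_2'\}$. Define a relation $\tau$ on $\mathcal B_n$ by: $(\alpha,\beta)\in\tau$ if and only if * $\alpha,\beta\notin K$; or * $\alpha,\beta\in J$ and $\widehat\alpha=\widehat\beta$; or * $\alpha,\beta\in K\setminus J$ and $U\alpha=U\beta$. A (right) action of $\mathcal B_n$ on a set $X$ is a map $\mu:X\times\mathcal B_n\to X$ with $\mu(\mu(x,\alpha),\beta)=\mu(x,\alpha\beta)$; it is faithful if distinct elements of $\mathcal B_n$ induce distinct self-maps of $X$. A sub-act is a subset closed under the action. Then $\tau$ is a right congruence (an equivalence relation such that $(\alpha,\beta)\in\tau$ implies $(\alpha\theta,\beta\theta)\in\tau$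 for all $\theta$). Writing $[\alpha]$ for the $\tau$-class of $\alpha$, the following are well defined: * the action $\mu_1$ of $\mathcal B_n$ on $\Omega_1=R_\gamma\cup R_\zeta$ given by $\mu_1(\alpha,\beta)=\alpha\beta$; * the action $\mu_2$ of $\mathcal B_n$ on $\Omega_2=\{[\alpha]:\alpha\in I_4\}$ given by $\mu_2([\alpha],\beta)=[\alpha\beta]$; * the isomorphism $\xi:R_\zeta\to\Omega_3$, $\alpha\mapsto[\alpha]$, from the sub-act $R_\zeta$ of $\Omega_1$ to the sub-act $\Omega_3=\{[\alpha]:\alpha\in J\}$ of $\Omega_2$. The push-out $\mu=\mu_1\sqcup_\xi\mu_2$, i.e. the action induced by $\mu_1$ and $\mu_2$ on the quotient $\Omega$ of the disjoint union $\Omega_1\sqcup\Omega_2$ obtained by identifying $\alpha$ with $\xi(\alpha)$ for each $\alpha\in R_\zeta$, is faithful, and $|\Omega|=1+3p_4+2p_2+p_0$. Consequently $$\deg(\mathcal B_n)\le 1+3p_4+2p_2+p_0,$$ where $\deg(S)$ is the least $m\ge1$ such that the semigroup $S$ embeds in the monoid of all self-maps of an $m$-element set, composed from left to right. -/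

import Mathlib

/-! ## Set partitions of two rows of `n` vertices, and their product -/

/-- The set partitions of `{1,…,n} ∪ {1',…,n'}`, given as equivalence relations.
`Sum.inl i` is the upper vertex `i`, and `Sum.inr i` is the lower vertex `i'`. -/
def Partn (n : ℕ) : Type := Setoid (Fin n ⊕ Fin n)

namespace Partn

variable {n : ℕ}

/-- `α.Rel x y`: the vertices `x` and `y` are in the same block of `α`. -/
def Rel (α : Partn n) (x y : Fin n ⊕ Fin n) : Prop := Setoid.r (self := α) x y

theorem Rel.refl (α : Partn n) (x : Fin n ⊕ Fin n) : α.Rel x x := α.iseqv.refl x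

theorem Rel.symm {α : Partn n} {x y : Fin n ⊕ Fin n} (h : α.Rel x y) : α.Rel y x :=
  α.iseqv.symm h

theorem Rel.trans {α : Partn n} {x y z : Fin n ⊕ Fin n} (h : α.Rel x y) (h' : α.Rel y z) :
    α.Rel x z := α.iseqv.trans h h'

@[ext] theorem ext {α β : Partn n} (h : ∀ x y, α.Rel x y ↔ β.Rel x y) : α = β :=
  Setoid.ext h

/-- The vertices of the product graph: the upper row, the middle row and the lower row. -/
abbrev Vert (n : ℕ) : Type := Fin n ⊕ (Fin n ⊕ Fin n)

/-- The upper factor of a product occupies the upper and the middle row. -/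
def topEmb : Fin n ⊕ Fin n → Vert n := Sum.elim Sum.inl (fun i => Sum.inr (Sum.inl i))

/-- The lower factor of a product occupies the middle and the lower row. -/
def botEmb : Fin n ⊕ Fin n → Vert n := Sum.inr

/-- The product itself occupies the upper and the lower row. -/
def outEmb : Fin n ⊕ Fin n → Vert n := Sum.elim Sum.inl (fun i => Sum.inr (Sum.inr i))

/-- Adjacency in the product graph of `α` and `β`. -/
inductive ProdAdj (α β : Partn n) : Vert n → Vert n → Prop
  | top {x y : Fin n ⊕ Fin n} : α.Rel x y → ProdAdj α β (topEmb x) (topEmb y)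
  | bot {x y : Fin n ⊕ Fin n} : β.Rel x y → ProdAdj α β (botEmb x) (botEmb y)

/-- Two outer vertices are in the same block of `α * β` if and only if they are in the same
connected component of the product graph. -/
instance : Mul (Partn n) :=
  ⟨fun α β => (Relation.EqvGen.setoid (ProdAdj α β)).comap outEmb⟩

/-- The identity has the blocks `{i, i'}`. -/
instance : One (Partn n) := ⟨Setoid.ker (Sum.elim id id : Fin n ⊕ Fin n → Fin n)⟩

theorem mul_rel {α β : Partn n} {x y : Fin n ⊕ Fin n} :
    (α * β).Rel x y ↔ Relation.EqvGen (ProdAdj α β) (outEmb x) (outEmb y) := Iff.rfl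

theorem one_rel {x y : Fin n ⊕ Fin n} :
    (1 : Partn n).Rel x y ↔ Sum.elim id id x = (Sum.elim id id y : Fin n) := Iff.rfl

theorem eqvGen_lift {V Q : Type} {r : V → V → Prop} (f : V → Q)
    (hf : ∀ a b, r a b → f a = f b) {a b : V} (h : Relation.EqvGen r a b) : f a = f b := by
  induction h with
  | rel _ _ h => exact hf _ _ h
  | refl _ => rfl
  | symm _ _ _ ih => exact ih.symm
  | trans _ _ _ _ _ ih1 ih2 => exact ih1.trans ih2

theorem eqvGen_map {V W : Type} {r : V → V → Prop} {s : W → W → Prop} (f : V → W)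
    (hf : ∀ a b, r a b → Relation.EqvGen s (f a) (f b)) {a b : V} (h : Relation.EqvGen r a b) :
    Relation.EqvGen s (f a) (f b) := by
  induction h with
  | rel _ _ h => exact hf _ _ h
  | refl _ => exact .refl _
  | symm _ _ _ ih => exact .symm _ _ ih
  | trans _ _ _ _ _ ih1 ih2 => exact .trans _ _ _ ih1 ih2

/-- Interchanging the upper and the lower row. -/
def star (α : Partn n) : Partn n := Setoid.comap Sum.swap α

theorem star_rel {α : Partn n} {x y : Fin n ⊕ Fin n} :
    α.star.Rel x y ↔ α.Rel x.swap y.swap := Iff.rfl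

theorem star_star (α : Partn n) : α.star.star = α := by
  ext x y; simp [star_rel]

/-- Turning the product graph upside down. -/
def flipV : Vert n → Vert n :=
  Sum.elim (fun i => Sum.inr (Sum.inr i)) (Sum.elim (fun i => Sum.inr (Sum.inl i)) Sum.inl)

theorem flipV_top (x : Fin n ⊕ Fin n) : flipV (topEmb x) = botEmb x.swap := by
  cases x <;> rfl

theorem flipV_bot (x : Fin n ⊕ Fin n) : flipV (botEmb x) = topEmb x.swap := by
  cases x <;> rfl

theorem flipV_out (x : Fin n ⊕ Fin n) : flipV (outEmb x) = outEmb x.swap := by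
  cases x <;> rfl

theorem star_mul_rel {α β : Partn n} {x y : Fin n ⊕ Fin n}
    (h : (α * β).Rel x y) : (β.star * α.star).Rel x.swap y.swap := by
  rw [mul_rel] at *
  rw [← flipV_out, ← flipV_out]
  refine eqvGen_map flipV ?_ h
  rintro _ _ (⟨h⟩ | ⟨h⟩)
  · rw [flipV_top, flipV_top]
    exact .rel _ _ (.bot (by simpa [star_rel] using h))
  · rw [flipV_bot, flipV_bot]
    exact .rel _ _ (.top (by simpa [star_rel] using h))

theorem star_mul (α β : Partn n) : (α * β).star = β.star * α.star := by
  ext x y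
  constructor
  · intro h
    simpa using star_mul_rel (α := α) (β := β) (x := x.swap) (y := y.swap) h
  · intro h
    have := star_mul_rel h
    rwa [star_star, star_star] at this

/-- One half of associativity; the other half follows by turning the graphs upside down. -/
theorem mul_assoc_rel {α β γ : Partn n} {x y : Fin n ⊕ Fin n}
    (h : (α * (β * γ)).Rel x y) : (α * β * γ).Rel x y := by
  classical
  -- a labelling of the product graph of `α` and `β` that is constant on its components and
  -- agrees, on the outer vertices, with the components of the product graph of `α * β` and `γ`
  let Q := Quot (ProdAdj (α * β) γ)
  let q : Vert n → Q := Quot.mk _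
  let g : Vert n → Q ⊕ Quot (ProdAdj α β) := fun u =>
    if h : ∃ w, Relation.EqvGen (ProdAdj α β) u (outEmb w) then
      Sum.inl (q (topEmb h.choose)) else Sum.inr (Quot.mk _ u)
  have hg1 : ∀ u v, Relation.EqvGen (ProdAdj α β) u v → g u = g v := by
    intro u v huv
    by_cases hu : ∃ w, Relation.EqvGen (ProdAdj α β) u (outEmb w)
    · have hv : ∃ w, Relation.EqvGen (ProdAdj α β) v (outEmb w) :=
        ⟨hu.choose, .trans _ _ _ (.symm _ _ huv) hu.choose_spec⟩
      simp only [g, dif_pos hu, dif_pos hv]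
      congr 1
      refine Quot.sound (.top ?_)
      rw [mul_rel]
      exact .trans _ _ _ (.symm _ _ hu.choose_spec) (.trans _ _ _ huv hv.choose_spec)
    · have hv : ¬ ∃ w, Relation.EqvGen (ProdAdj α β) v (outEmb w) :=
        fun ⟨w, hw⟩ => hu ⟨w, .trans _ _ _ huv hw⟩
      simp only [g, dif_neg hu, dif_neg hv]
      congr 1
      exact Quot.eqvGen_sound huv
  have hg2 : ∀ w, g (outEmb w) = Sum.inl (q (topEmb w)) := by
    intro w
    have hu : ∃ w', Relation.EqvGen (ProdAdj α β) (outEmb w) (outEmb w') := ⟨w, .refl _⟩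
    simp only [g, dif_pos hu]
    congr 1
    refine Quot.sound (.top ?_)
    rw [mul_rel]
    exact .symm _ _ hu.choose_spec
  -- the labels of the rows 2, 3, 4 of the four-row graph
  let l : Vert n → Q ⊕ Quot (ProdAdj α β) :=
    Sum.elim (fun i => g (Sum.inr (Sum.inl i)))
      (Sum.elim (fun i => Sum.inl (q (Sum.inr (Sum.inl i))))
        (fun i => Sum.inl (q (Sum.inr (Sum.inr i)))))
  have hl : ∀ u v, ProdAdj β γ u v → l u = l v := by
    have h1 : ∀ x : Fin n ⊕ Fin n, l (topEmb x) = g (botEmb x) := by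
      rintro (i | i)
      · rfl
      · exact (hg2 (Sum.inr i)).symm
    have h2 : ∀ x : Fin n ⊕ Fin n, l (botEmb x) = Sum.inl (q (botEmb x)) := by
      rintro (i | i) <;> rfl
    rintro _ _ (⟨h⟩ | ⟨h⟩)
    · rw [h1, h1]; exact hg1 _ _ (.rel _ _ (.bot h))
    · rw [h2, h2]; congr 1; exact Quot.sound (.bot h)
  -- the labels of the rows 1, 2, 4
  let m : Vert n → Q ⊕ Quot (ProdAdj α β) :=
    Sum.elim (fun i => Sum.inl (q (Sum.inl i)))
      (Sum.elim (fun i => g (Sum.inr (Sum.inl i)))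
        (fun i => Sum.inl (q (Sum.inr (Sum.inr i)))))
  have hm : ∀ u v, ProdAdj α (β * γ) u v → m u = m v := by
    have h1 : ∀ x : Fin n ⊕ Fin n, m (topEmb x) = g (topEmb x) := by
      rintro (i | i)
      · exact (hg2 (Sum.inl i)).symm
      · rfl
    have h2 : ∀ x : Fin n ⊕ Fin n, m (botEmb x) = l (outEmb x) := by
      rintro (i | i) <;> rfl
    rintro _ _ (⟨h⟩ | ⟨h⟩)
    · rw [h1, h1]; exact hg1 _ _ (.rel _ _ (.top h))
    · rw [h2, h2]; exact eqvGen_lift l hl h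
  have h3 : ∀ x : Fin n ⊕ Fin n, m (outEmb x) = Sum.inl (q (outEmb x)) := by
    rintro (i | i) <;> rfl
  have := eqvGen_lift m hm h
  rw [h3, h3] at this
  exact Quot.eqvGen_exact (Sum.inl_injective this)

theorem mul_assoc' (α β γ : Partn n) : α * β * γ = α * (β * γ) := by
  ext x y
  constructor
  · intro h
    have h1 := star_mul_rel h
    rw [star_mul] at h1
    have h2 := star_mul_rel (mul_assoc_rel h1)
    simpa [star_mul, star_star] using h2
  · exact mul_assoc_rel

theorem one_mul' (α : Partn n) : 1 * α = α := by
  ext x y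
  constructor
  · intro h
    let f : Vert n → Quotient (α : Setoid (Fin n ⊕ Fin n)) :=
      Sum.elim (fun i => Quotient.mk _ (Sum.inl i)) (fun x => Quotient.mk _ x)
    have hf : ∀ u v, ProdAdj 1 α u v → f u = f v := by
      rintro _ _ (⟨h⟩ | ⟨h⟩)
      · rw [one_rel] at h
        rename_i a b
        rcases a with a | a <;> rcases b with b | b <;> simp at h <;> subst h <;> rfl
      · exact Quotient.sound h
    have := eqvGen_lift f hf (mul_rel.1 h)
    have h3 : ∀ x : Fin n ⊕ Fin n, f (outEmb x) = Quotient.mk _ x := by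
      rintro (i | i) <;> rfl
    rw [h3, h3] at this
    exact Quotient.exact this
  · intro h
    have h1 : ∀ x : Fin n ⊕ Fin n,
        Relation.EqvGen (ProdAdj 1 α) (outEmb x) (botEmb x) := by
      rintro (i | i)
      · exact .rel _ _ (.top (x := Sum.inl i) (y := Sum.inr i) rfl)
      · exact .refl _
    exact mul_rel.2 (.trans _ _ _ (h1 x) (.trans _ _ _ (.rel _ _ (.bot h)) (.symm _ _ (h1 y))))

theorem star_one : (1 : Partn n).star = 1 := by
  ext x y
  rw [star_rel, one_rel, one_rel]
  cases x <;> cases y <;> rfl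

theorem mul_one' (α : Partn n) : α * 1 = α := by
  rw [← star_star (α * 1), star_mul, star_one, one_mul', star_star]

/-- The partition monoid. -/
instance : Monoid (Partn n) where
  mul_assoc := mul_assoc'
  one_mul := one_mul'
  mul_one := mul_one'

/-- The rank: the number of blocks that contain both upper and lower vertices. -/
noncomputable def rank (α : Partn n) : ℕ :=
  {C ∈ Setoid.classes α | (∃ i, Sum.inl i ∈ C) ∧ ∃ j, Sum.inr j ∈ C}.ncard

/-- Every block has exactly two elements. -/
def AllPairs (α : Partn n) : Prop := ∀ x, {y | α.Rel x y}.ncard = 2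

theorem allPairs_iff {α : Partn n} : α.AllPairs ↔
    ∃ a : Fin n ⊕ Fin n → Fin n ⊕ Fin n,
      (∀ x, a x ≠ x) ∧ (∀ x, a (a x) = x) ∧ ∀ x y, α.Rel x y ↔ y = x ∨ y = a x := by
  constructor
  · intro h
    have h1 : ∀ x, ∃ z, z ≠ x ∧ ∀ y, α.Rel x y ↔ y = x ∨ y = z := by
      intro x
      obtain ⟨u, v, huv, hs⟩ := Set.ncard_eq_two.1 (h x)
      have hs' : ∀ y, α.Rel x y ↔ y = u ∨ y = v := fun y => by
        have := Set.ext_iff.1 hs y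
        simpa using this
      rcases (hs' x).1 (Rel.refl α x) with rfl | rfl
      · exact ⟨v, huv.symm, hs'⟩
      · exact ⟨u, huv, fun y => (hs' y).trans or_comm⟩
    choose a ha1 ha2 using h1
    refine ⟨a, ha1, fun x => ?_, ha2⟩
    have h2 : α.Rel (a x) x := ((ha2 x (a x)).2 (Or.inr rfl)).symm
    rcases (ha2 (a x) x).1 h2 with h3 | h3
    · exact absurd h3.symm (ha1 x)
    · exact h3.symm
  · rintro ⟨a, h1, -, h3⟩ x
    have : {y | α.Rel x y} = {x, a x} := by
      ext y; simpa using h3 x y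
    rw [this, Set.ncard_pair (h1 x).symm]

/-- The ends of the edges of the product graph: those of the upper factor, then those of the
lower factor. -/
abbrev Dart (n : ℕ) : Type := (Fin n ⊕ Fin n) ⊕ (Fin n ⊕ Fin n)

/-- The vertex at an end of an edge. -/
def dartVert : Dart n → Vert n := Sum.elim topEmb botEmb

/-- Passing from a factor to the other one at a vertex of the middle row. -/
def glue : Dart n → Dart n :=
  Sum.elim (Sum.elim (fun i => Sum.inl (Sum.inl i)) (fun i => Sum.inr (Sum.inl i)))
    (Sum.elim (fun i => Sum.inl (Sum.inr i)) (fun i => Sum.inr (Sum.inr i)))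

/-- The edge end at a vertex of the upper or the lower row. -/
def outDart : Fin n ⊕ Fin n → Dart n :=
  Sum.elim (fun i => Sum.inl (Sum.inl i)) (fun i => Sum.inr (Sum.inr i))

theorem glue_glue (d : Dart n) : glue (glue d) = d := by
  rcases d with (i | i) | (i | i) <;> rfl

theorem dartVert_glue (d : Dart n) : dartVert (glue d) = dartVert d := by
  rcases d with (i | i) | (i | i) <;> rfl

theorem glue_eq_self {d : Dart n} : glue d = d ↔ ∃ x, d = outDart x := by
  rcases d with (i | i) | (i | i) <;> simp [glue, outDart]

theorem dartVert_eq {d d' : Dart n} (h : dartVert d = dartVert d') : d' = d ∨ d' = glue d := by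
  rcases d with (i | i) | (i | i) <;> rcases d' with (j | j) | (j | j) <;>
    simp_all [dartVert, topEmb, botEmb, glue]

theorem dartVert_out (x : Fin n ⊕ Fin n) : dartVert (outDart x) = outEmb x := by
  cases x <;> rfl

theorem outDart_injective : Function.Injective (outDart : Fin n ⊕ Fin n → Dart n) := by
  rintro (i | i) (j | j) h <;> simp_all [outDart]

/-- In an orbit of two involutions on a finite set, the first without fixed points, that
contains a fixed point of the second, there is exactly one more fixed point of the second. -/
theorem dihedral_orbit {D : Type} [Finite D] (e g : Equiv.Perm D) (he : ∀ d, e (e d) = d)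
    (hg : ∀ d, g (g d) = d) (he' : ∀ d, e d ≠ d) (d : D) (hd : g d = d) :
    ∃ d', d' ≠ d ∧ g d' = d' ∧ (∃ i : ℤ, d' = ((e * g) ^ i) d) ∧
      (∀ i : ℤ, g (((e * g) ^ i) d) = ((e * g) ^ i) d →
        ((e * g) ^ i) d = d ∨ ((e * g) ^ i) d = d') ∧
      (∀ i : ℤ, ∃ j : ℤ, g (((e * g) ^ i) d) = ((e * g) ^ j) d) ∧
      (∀ i : ℤ, ∃ j : ℤ, e (((e * g) ^ i) d) = ((e * g) ^ j) d) := by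
  have hgg : g * g = 1 := by ext x; exact hg x
  have hee : e * e = 1 := by ext x; exact he x
  have hginv : g⁻¹ = g := inv_eq_of_mul_eq_one_left hgg
  have heinv : e⁻¹ = e := inv_eq_of_mul_eq_one_left hee
  set p : Equiv.Perm D := e * g with hp
  have hconj : g * p * g⁻¹ = p⁻¹ := by
    rw [hp, mul_inv_rev, hginv, heinv]; simp [mul_assoc, hgg]
  have hgp : ∀ i : ℤ, g ((p ^ i) d) = (p ^ (-i)) d := by
    intro i
    have h1 : g * p ^ i = p ^ (-i) * g := by
      have := conj_zpow (i := i) (a := g) (b := p)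
      rw [hconj, inv_zpow'] at this
      rw [this, inv_mul_cancel_right]
    have h2 := congrArg (fun f : Equiv.Perm D => f d) h1
    simpa [hd] using h2
  have hep : ∀ i : ℤ, e ((p ^ i) d) = (p ^ (1 - i)) d := by
    intro i
    have h1 : e = p * g := by rw [hp, mul_assoc, hgg, mul_one]
    have h2 : (p ^ (1 - i)) d = p ((p ^ (-i)) d) := by
      rw [sub_eq_add_neg, zpow_add, zpow_one]; rfl
    rw [h2, ← hgp i]
    conv_lhs => rw [h1]
    rfl
  set m := MulAction.period p d with hm
  have hper : ∀ i : ℤ, (p ^ i) d = d ↔ (m : ℤ) ∣ i := by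
    intro i
    exact MulAction.zpow_smul_eq_iff_period_dvd (g := p) (a := d) (j := i)
  have heq : ∀ i j : ℤ, (p ^ i) d = (p ^ j) d ↔ (m : ℤ) ∣ i - j := by
    intro i j
    rw [← hper, sub_eq_neg_add, zpow_add, Equiv.Perm.mul_apply, zpow_neg,
      Equiv.Perm.inv_eq_iff_eq]
  have hmpos : 0 < m := MulAction.period_pos_of_orderOf_pos (orderOf_pos p) d
  obtain ⟨h, hh⟩ : ∃ h, m = 2 * h := by
    rcases Nat.even_or_odd' m with ⟨h, hh | hh⟩
    · exact ⟨h, hh⟩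
    · exfalso
      refine he' ((p ^ ((h : ℤ) + 1)) d) ?_
      rw [hep, heq]
      exact ⟨-1, by rw [hh]; push_cast; ring⟩
  refine ⟨(p ^ (h : ℤ)) d, ?_, ?_, ⟨h, rfl⟩, ?_, fun i => ⟨-i, hgp i⟩, fun i => ⟨1 - i, hep i⟩⟩
  · rw [Ne, hper]
    rintro ⟨c, hc⟩
    rw [hh] at hc
    push_cast at hc
    have : (h : ℤ) * (1 - 2 * c) = 0 := by linear_combination hc
    rcases mul_eq_zero.1 this with h0 | h0 <;> omega
  · rw [hgp, heq]
    exact ⟨-1, by rw [hh]; push_cast; ring⟩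
  · intro i hi
    rw [hgp, heq] at hi
    obtain ⟨c, hc⟩ := hi
    have hi' : i = -(h * c) := by
      rw [hh] at hc; push_cast at hc; linarith
    rw [hper, heq]
    rcases Int.even_or_odd' c with ⟨b, hb | hb⟩
    · left; exact ⟨-b, by rw [hi', hb, hh]; push_cast; ring⟩
    · right; exact ⟨-b - 1, by rw [hi', hb, hh]; push_cast; ring⟩

theorem AllPairs.mul {α β : Partn n} (hα : α.AllPairs) (hβ : β.AllPairs) :
    (α * β).AllPairs := by
  obtain ⟨a, a1, a2, a3⟩ := allPairs_iff.1 hα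
  obtain ⟨b, b1, b2, b3⟩ := allPairs_iff.1 hβ
  have e2 : ∀ d : Dart n, Sum.map a b (Sum.map a b d) = d := by
    rintro (x | x) <;> simp [a2, b2]
  let e : Equiv.Perm (Dart n) := ⟨Sum.map a b, Sum.map a b, e2, e2⟩
  let g : Equiv.Perm (Dart n) := ⟨glue, glue, glue_glue, glue_glue⟩
  have e1 : ∀ d, e d ≠ d := by
    rintro (x | x) h
    · exact a1 x (Sum.inl_injective h)
    · exact b1 x (Sum.inr_injective h)
  have hE : ∀ d, Relation.EqvGen (ProdAdj α β) (dartVert d) (dartVert (e d)) := by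
    rintro (x | x)
    · exact .rel _ _ (.top ((a3 x _).2 (Or.inr rfl)))
    · exact .rel _ _ (.bot ((b3 x _).2 (Or.inr rfl)))
  have hG : ∀ d, dartVert (g d) = dartVert d := dartVert_glue
  intro x
  obtain ⟨d', hne, hgd', ⟨i', hi'⟩, huniq, hg, he⟩ := dihedral_orbit e g e2 glue_glue e1
    (outDart x) (glue_eq_self.2 ⟨x, rfl⟩)
  obtain ⟨z, rfl⟩ := glue_eq_self.1 hgd'
  set p := e * g with hp
  set d := outDart x with hd
  -- the orbit is connected
  have hconn : ∀ i : ℤ, Relation.EqvGen (ProdAdj α β) (dartVert d) (dartVert ((p ^ i) d)) := by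
    have hstep : ∀ d, Relation.EqvGen (ProdAdj α β) (dartVert d) (dartVert (p d)) := by
      intro d
      have := hE (g d)
      rwa [hG] at this
    intro i
    induction i with
    | zero => exact .refl _
    | succ i ih =>
      refine .trans _ _ _ ih ?_
      rw [add_comm, zpow_add, zpow_one]
      exact hstep _
    | pred i ih =>
      refine .trans _ _ _ ih (.symm _ _ ?_)
      have h1 : (p ^ (-(i : ℤ))) d = p ((p ^ (-(i : ℤ) - 1)) d) := by
        rw [← Equiv.Perm.mul_apply, ← zpow_one_add]; congr 2; ring
      rw [h1]
      exact hstep _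
  -- the orbit is a union of connected components
  let f : Vert n → Prop := fun v => ∃ i : ℤ, dartVert ((p ^ i) d) = v
  have hf0 : ∀ c : Dart n, f (dartVert c) → ∃ i : ℤ, c = (p ^ i) d := by
    rintro c ⟨i, hi⟩
    rcases dartVert_eq hi with h | h
    · exact ⟨i, h⟩
    · obtain ⟨j, hj⟩ := hg i
      exact ⟨j, h.trans hj⟩
  have hf1 : ∀ c : Dart n, f (dartVert c) → f (dartVert (e c)) := by
    intro c hc
    obtain ⟨i, rfl⟩ := hf0 c hc
    obtain ⟨j, hj⟩ := he i
    exact ⟨j, by rw [← hj]⟩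
  have hf2 : ∀ c : Dart n, f (dartVert c) = f (dartVert (e c)) := by
    intro c
    refine propext ⟨hf1 c, fun h => ?_⟩
    have := hf1 _ h
    rwa [show e (e c) = c from e2 c] at this
  have hf : ∀ u v, ProdAdj α β u v → f u = f v := by
    rintro _ _ (⟨h⟩ | ⟨h⟩)
    · rename_i s t
      rcases (a3 s t).1 h with rfl | rfl
      · rfl
      · exact hf2 (Sum.inl s)
    · rename_i s t
      rcases (b3 s t).1 h with rfl | rfl
      · rfl
      · exact hf2 (Sum.inr s)
  have key : {y | (α * β).Rel x y} = {x, z} := by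
    ext y
    simp only [Set.mem_ofPred_eq, Set.mem_insert_iff, Set.mem_singleton_iff, mul_rel]
    constructor
    · intro h
      have h1 := eqvGen_lift f hf h
      have h2 : f (outEmb x) := ⟨0, by rw [← dartVert_out]; rfl⟩
      rw [h1, ← dartVert_out] at h2
      obtain ⟨i, hi⟩ := hf0 _ h2
      have h3 : g ((p ^ i) d) = (p ^ i) d := by
        rw [← hi]; exact glue_eq_self.2 ⟨y, rfl⟩
      rcases huniq i h3 with h4 | h4 <;> rw [← hi] at h4
      · exact Or.inl (outDart_injective h4)
      · exact Or.inr (outDart_injective h4)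
    · rintro (rfl | rfl)
      · exact .refl _
      · have := hconn i'
        rwa [← hi', hd, dartVert_out, dartVert_out] at this
  rw [key, Set.ncard_pair]
  rintro rfl
  exact hne rfl

theorem AllPairs.one : (1 : Partn n).AllPairs := by
  rw [allPairs_iff]
  refine ⟨Sum.swap, ?_, ?_, ?_⟩
  · rintro (i | i) <;> simp
  · simp
  · rintro (i | i) (j | j) <;> simp [one_rel, eq_comm]

end Partn

/-- The Brauer monoid: all blocks have size two. -/
def Brauer (n : ℕ) : Submonoid (Partn n) where
  carrier := {α | α.AllPairs}
  mul_mem' := Partn.AllPairs.mul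
  one_mem' := Partn.AllPairs.one

/-! ## Actions and transformation degrees -/

/-- A right action of a semigroup `S` on a set `X`. -/
structure RightAction (X S : Type) [Mul S] where
  /-- the map `X × S → X` -/
  act : X → S → X
  act_act : ∀ x a b, act (act x a) b = act x (a * b)

namespace RightAction

variable {X X₁ X₂ S : Type} [Mul S]

/-- Different elements act differently. -/
def Faithful (μ : RightAction X S) : Prop :=
  ∀ a b : S, (∀ x, μ.act x a = μ.act x b) → a = b

/-- A subset closed under the action. -/
def IsSubAct (μ : RightAction X S) (Y : Set X) : Prop := ∀ y ∈ Y, ∀ a, μ.act y a ∈ Y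

/-- An isomorphism from a sub-act `Y₁` of `μ₁` to a sub-act `Y₂` of `μ₂`. -/
structure SubActIso (μ₁ : RightAction X₁ S) (μ₂ : RightAction X₂ S) (Y₁ : Set X₁)
    (Y₂ : Set X₂) where
  isSubAct₁ : μ₁.IsSubAct Y₁
  isSubAct₂ : μ₂.IsSubAct Y₂
  /-- the underlying bijection -/
  toEquiv : Y₁ ≃ Y₂
  map_act : ∀ (y : Y₁) (a : S),
    (toEquiv ⟨μ₁.act y a, isSubAct₁ y y.2 a⟩ : X₂) = μ₂.act (toEquiv y) a

/-- The pairs that the push-out identifies: `y` and its image, for each `y ∈ Y₁`. -/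
inductive PushoutRel {μ₁ : RightAction X₁ S} {μ₂ : RightAction X₂ S} {Y₁ : Set X₁} {Y₂ : Set X₂}
    (ξ : SubActIso μ₁ μ₂ Y₁ Y₂) : X₁ ⊕ X₂ → X₁ ⊕ X₂ → Prop
  | glue (y : Y₁) : PushoutRel ξ (Sum.inl y) (Sum.inr (ξ.toEquiv y))

/-- The underlying set of the push-out: the quotient of the disjoint union by the equivalence
relation generated by the identified pairs. -/
def Pushout {μ₁ : RightAction X₁ S} {μ₂ : RightAction X₂ S} {Y₁ : Set X₁} {Y₂ : Set X₂}
    (ξ : SubActIso μ₁ μ₂ Y₁ Y₂) : Type := Quot (PushoutRel ξ)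

/-- The push-out of two actions along an isomorphism of sub-acts. -/
def pushout {μ₁ : RightAction X₁ S} {μ₂ : RightAction X₂ S} {Y₁ : Set X₁} {Y₂ : Set X₂}
    (ξ : SubActIso μ₁ μ₂ Y₁ Y₂) : RightAction (Pushout ξ) S where
  act x a := Quot.map (Sum.map (fun x => μ₁.act x a) (fun x => μ₂.act x a))
    (by
      rintro _ _ ⟨y⟩
      have h := PushoutRel.glue (ξ := ξ) ⟨μ₁.act y a, ξ.isSubAct₁ y y.2 a⟩
      rw [ξ.map_act] at h
      exact h) x
  act_act x a b := by
    induction x using Quot.ind with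
    | mk x => rcases x with x | x <;> simp [Quot.map, act_act] <;> rfl

end RightAction

/-- The minimum transformation degree: the least `m ≥ 1` such that `S` embeds in the full
transformation monoid of a set of size `m`, whose elements are composed from left to right. -/
noncomputable def transDegree (S : Type) [Mul S] : ℕ :=
  sInf {m : ℕ | 1 ≤ m ∧ ∃ f : S →ₙ* (Function.End (Fin m))ᵐᵒᵖ, Function.Injective f}

/-! ## Green's relations and right congruences -/

section Green

variable {S : Type} [Monoid S]

/-- Green's preorder `a ≤ b` for the relation `R`, that is, `a ∈ bS`. -/
def GreenRLe (a b : S) : Prop := ∃ s, a = b * s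

/-- Green's relation `R`. -/
def GreenR (a b : S) : Prop := GreenRLe a b ∧ GreenRLe b a

/-- Green's relative relation `L` with respect to a submonoid `U`: `Ua = Ub`. -/
def GreenLRel (U : Submonoid S) (a b : S) : Prop :=
  (fun u => u * a) '' (U : Set S) = (fun u => u * b) '' (U : Set S)

/-- A right congruence: a right-compatible equivalence relation. -/
def IsRightCongruence (r : Setoid S) : Prop := ∀ a b s : S, r a b → r (a * s) (b * s)

end Green

/-! ## The specific objects in the Brauer monoid of even degree `2k` -/

namespace Brauer

/-- The number of projections (`ε² = ε = ε*`) of rank `r`. -/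
noncomputable def numProj (n r : ℕ) : ℕ :=
  {ε : Brauer n | ε * ε = ε ∧ (ε : Partn n).star = ε ∧ (ε : Partn n).rank = r}.ncard

variable (k : ℕ)

/-- The position of a vertex in its row, counted from `0`. -/
def pos {n : ℕ} : Fin n ⊕ Fin n → ℕ := Sum.elim Fin.val Fin.val

/-- The partition with the upper blocks `{1,2}, {3,4}, …, {2k-1,2k}` and the lower blocks
`{1',2'}, {3',4'}, …, {(2k-1)',(2k)'}`. -/
def zetaPartn : Partn (2 * k) :=
  Setoid.ker (fun x : Fin (2 * k) ⊕ Fin (2 * k) => (x.isLeft, pos x / 2))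

/-- The partition with the blocks `{1,1'}`, `{2,2'}`, `{3,4}, …, {2k-1,2k}`,
`{3',4'}, …, {(2k-1)',(2k)'}`. -/
def gammaPartn : Partn (2 * k) :=
  Setoid.ker (fun x : Fin (2 * k) ⊕ Fin (2 * k) =>
    if pos x < 2 then Sum.inl (pos x) else Sum.inr (x.isLeft, pos x / 2) : _ → ℕ ⊕ (Bool × ℕ))

/-- The neighbour of `i` among the pairs `{0,1}, {2,3}, …`. -/
def buddy {k : ℕ} (i : Fin (2 * k)) : Fin (2 * k) :=
  ⟨if (i : ℕ) % 2 = 0 then i + 1 else i - 1, by have := i.2; split <;> omega⟩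

theorem buddy_ne {k : ℕ} (i : Fin (2 * k)) : buddy i ≠ i := by
  intro h
  have h := congrArg Fin.val h
  simp only [buddy] at h
  split at h <;> omega

theorem buddy_buddy {k : ℕ} (i : Fin (2 * k)) : buddy (buddy i) = i := by
  apply Fin.ext
  simp only [buddy]
  split_ifs <;> omega

theorem half_eq_iff {k : ℕ} (i j : Fin (2 * k)) :
    (i : ℕ) / 2 = (j : ℕ) / 2 ↔ j = i ∨ j = buddy i := by
  rw [Fin.ext_iff, Fin.ext_iff]
  simp only [buddy]
  split_ifs <;> omega

theorem zetaPartn_rel {x y : Fin (2 * k) ⊕ Fin (2 * k)} : (zetaPartn k).Rel x y ↔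
    (x.isLeft, pos x / 2) = (y.isLeft, pos y / 2) := Iff.rfl

theorem gammaPartn_rel {x y : Fin (2 * k) ⊕ Fin (2 * k)} : (gammaPartn k).Rel x y ↔
    (if pos x < 2 then Sum.inl (pos x) else Sum.inr (x.isLeft, pos x / 2) : ℕ ⊕ (Bool × ℕ)) =
      if pos y < 2 then Sum.inl (pos y) else Sum.inr (y.isLeft, pos y / 2) := Iff.rfl

theorem zetaPartn_mem : zetaPartn k ∈ Brauer (2 * k) := by
  refine Partn.allPairs_iff.2 ⟨Sum.map buddy buddy, ?_, ?_, ?_⟩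
  · rintro (i | i) <;> simp [buddy_ne]
  · rintro (i | i) <;> simp [buddy_buddy]
  · rintro (i | i) (j | j) <;> simp [zetaPartn_rel, pos, half_eq_iff]

theorem gammaPartn_mem : gammaPartn k ∈ Brauer (2 * k) := by
  refine Partn.allPairs_iff.2
    ⟨fun x => if pos x < 2 then x.swap else Sum.map buddy buddy x, ?_, ?_, ?_⟩
  · rintro (i | i) <;> by_cases h : (i : ℕ) < 2 <;> simp [pos, h, buddy_ne]
  · have hb : ∀ i : Fin (2 * k), ¬ (i : ℕ) < 2 → ¬ (buddy i : ℕ) < 2 := by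
      intro i h
      simp only [buddy]
      split_ifs <;> omega
    rintro (i | i) <;> by_cases h : (i : ℕ) < 2
    · simp [pos, h]
    · have h' := hb i h
      simp only [pos, Sum.elim_inl, h, if_false, Sum.map_inl, h', buddy_buddy]
    · simp [pos, h]
    · have h' := hb i h
      simp only [pos, Sum.elim_inr, h, if_false, Sum.map_inr, h', buddy_buddy]
  · have hlt : ∀ i j : Fin (2 * k), (i : ℕ) < 2 → ¬ (j : ℕ) < 2 → j ≠ i := by
      rintro i j h1 h2 rfl; exact h2 h1
    have hlt' : ∀ i j : Fin (2 * k), ¬ (i : ℕ) < 2 → (j : ℕ) < 2 → j ≠ i ∧ j ≠ buddy i := by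
      intro i j h1 h2
      refine ⟨by rintro rfl; exact h1 h2, ?_⟩
      intro h
      have h := congrArg Fin.val h
      simp only [buddy] at h
      split_ifs at h <;> omega
    have heq : ∀ i j : Fin (2 * k), (i : ℕ) = j ↔ j = i := fun i j =>
      ⟨fun h => Fin.ext h.symm, fun h => h ▸ rfl⟩
    intro x y
    rw [gammaPartn_rel]
    rcases x with i | i <;> rcases y with j | j <;> by_cases hi : (i : ℕ) < 2 <;>
      by_cases hj : (j : ℕ) < 2 <;>
      simp only [pos, Sum.elim_inl, Sum.elim_inr, hi, hj, if_true, if_false, Sum.inl.injEq,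
        Sum.inr.injEq, Prod.mk.injEq, Sum.isLeft_inl, Sum.isLeft_inr, true_and, half_eq_iff, heq,
        Sum.swap_inl, Sum.swap_inr, Sum.map_inl, Sum.map_inr, reduceCtorEq, or_false, false_or,
        false_and, Bool.false_eq_true, Bool.true_eq_false]
    all_goals first
      | (have h := hlt i j hi hj; simp [h])
      | (have h := hlt' i j hi hj; simp [h.1, h.2])

/-- The partition `ζ`. -/
def zeta : Brauer (2 * k) := ⟨zetaPartn k, zetaPartn_mem k⟩

/-- The partition `γ`. -/
def gamma : Brauer (2 * k) := ⟨gammaPartn k, gammaPartn_mem k⟩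

/-- `I_r`: the elements of rank at most `r`. -/
def rankLe (n r : ℕ) : Set (Brauer n) := {α | (α : Partn n).rank ≤ r}

/-- `K`: the elements that are above `ζ` in the `R`-order. -/
def setK : Set (Brauer (2 * k)) := {α | GreenRLe (zeta k) α}

/-- `J`: the elements of rank at most two in `K`. -/
def setJ : Set (Brauer (2 * k)) := rankLe (2 * k) 2 ∩ setK k

/-- `U`: the stabiliser of `ζ` in the group of units (which is the symmetric group). -/
def stabU : Submonoid (Brauer (2 * k)) where
  carrier := {α | IsUnit α ∧ α * zeta k = zeta k}
  mul_mem' := by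
    rintro a b ⟨ha, ha'⟩ ⟨hb, hb'⟩
    exact ⟨ha.mul hb, by rw [mul_assoc, hb', ha']⟩
  one_mem' := ⟨isUnit_one, one_mul _⟩

/-- A vertex in a block with both upper and lower vertices. -/
def IsTransversal {n : ℕ} (α : Partn n) (x : Fin n ⊕ Fin n) : Prop :=
  ∃ y, α.Rel x y ∧ x.isLeft ≠ y.isLeft

/-- For an element `α` of rank two, with transversals `{a₁,b₁'}` and `{a₂,b₂'}`, the element of
rank zero that has the blocks `{a₁,a₂}` and `{b₁',b₂'}` instead; for `α` of rank zero, `α` itself.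
It is only used for these ranks. -/
def hat {n : ℕ} (α : Partn n) : Partn n where
  r x y := x.isLeft = y.isLeft ∧ (α.Rel x y ∨ (IsTransversal α x ∧ IsTransversal α y))
  iseqv := by
    have key : ∀ {x y : Fin n ⊕ Fin n}, x.isLeft = y.isLeft → α.Rel x y →
        IsTransversal α x → IsTransversal α y := by
      rintro x y h1 h2 ⟨z, hz, hz'⟩
      exact ⟨z, h2.symm.trans hz, h1 ▸ hz'⟩
    refine ⟨fun x => ⟨rfl, Or.inl (Partn.Rel.refl α x)⟩, ?_, ?_⟩
    · rintro x y ⟨h1, h2 | ⟨h2, h3⟩⟩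
      · exact ⟨h1.symm, Or.inl h2.symm⟩
      · exact ⟨h1.symm, Or.inr ⟨h3, h2⟩⟩
    · rintro x y z ⟨h1, h2 | ⟨h2, h3⟩⟩ ⟨h4, h5 | ⟨h5, h6⟩⟩
      · exact ⟨h1.trans h4, Or.inl (h2.trans h5)⟩
      · exact ⟨h1.trans h4, Or.inr ⟨key h1.symm h2.symm h5, h6⟩⟩
      · exact ⟨h1.trans h4, Or.inr ⟨h2, key h4 h5 h3⟩⟩
      · exact ⟨h1.trans h4, Or.inr ⟨h2, h6⟩⟩

/-- The relation `χ`: equality, or both elements have rank at most two and the same `hat`. -/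
def chi (n : ℕ) (α β : Brauer n) : Prop :=
  α = β ∨ (α ∈ rankLe n 2 ∧ β ∈ rankLe n 2 ∧ hat (α : Partn n) = hat (β : Partn n))

/-- The relation `τ`: universal on the complement of `K`, the relation `χ` on `J`, and the
relation `L` relative to `U` on `K \ J`. -/
def tau : Setoid (Brauer (2 * k)) where
  r α β := (α ∉ setK k ∧ β ∉ setK k) ∨ (α ∈ setJ k ∧ β ∈ setJ k ∧ chi (2 * k) α β) ∨
    (α ∈ setK k \ setJ k ∧ β ∈ setK k \ setJ k ∧ GreenLRel (stabU k) α β)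
  iseqv := by
    have hJK : ∀ α, α ∈ setJ k → α ∈ setK k := fun α h => h.2
    refine ⟨?_, ?_, ?_⟩
    · intro α
      by_cases h1 : α ∈ setK k
      · by_cases h2 : α ∈ setJ k
        · exact Or.inr (Or.inl ⟨h2, h2, Or.inl rfl⟩)
        · exact Or.inr (Or.inr ⟨⟨h1, h2⟩, ⟨h1, h2⟩, rfl⟩)
      · exact Or.inl ⟨h1, h1⟩
    · rintro α β (⟨h1, h2⟩ | ⟨h1, h2, h3⟩ | ⟨h1, h2, h3⟩)
      · exact Or.inl ⟨h2, h1⟩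
      · refine Or.inr (Or.inl ⟨h2, h1, ?_⟩)
        rcases h3 with rfl | ⟨h3, h4, h5⟩
        · exact Or.inl rfl
        · exact Or.inr ⟨h4, h3, h5.symm⟩
      · exact Or.inr (Or.inr ⟨h2, h1, h3.symm⟩)
    · rintro α β δ (⟨h1, h2⟩ | ⟨h1, h2, h3⟩ | ⟨h1, h2, h3⟩)
        (⟨h4, h5⟩ | ⟨h4, h5, h6⟩ | ⟨h4, h5, h6⟩)
      · exact Or.inl ⟨h1, h5⟩
      · exact absurd (hJK _ h4) h2
      · exact absurd h4.1 h2
      · exact absurd (hJK _ h2) h4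
      · refine Or.inr (Or.inl ⟨h1, h5, ?_⟩)
        rcases h3 with rfl | ⟨h3, h3', h3''⟩
        · exact h6
        · rcases h6 with rfl | ⟨h6, h6', h6''⟩
          · exact Or.inr ⟨h3, h3', h3''⟩
          · exact Or.inr ⟨h3, h6', h3''.trans h6''⟩
      · exact absurd h2 h4.2
      · exact absurd h2.1 h4
      · exact absurd h4 h2.2
      · exact Or.inr (Or.inr ⟨h1, h5, h3.trans h6⟩)

/-- `Ω₁ = R_γ ∪ R_ζ`. -/
def Omega1 : Set (Brauer (2 * k)) := {α | GreenR α (gamma k) ∨ GreenR α (zeta k)}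

/-- `R_ζ`, as a subset of `Ω₁`. -/
def Rzeta : Set (Omega1 k) := {α | GreenR (α : Brauer (2 * k)) (zeta k)}

/-- The `τ`-class of an element. -/
def tauClass (α : Brauer (2 * k)) : Quotient (tau k) := Quotient.mk (tau k) α

/-- `Ω₂`: the `τ`-classes of the elements of rank at most four. -/
def Omega2 : Set (Quotient (tau k)) := tauClass k '' rankLe (2 * k) 4

/-- `Ω₃`: the `τ`-classes of the elements of `J`, as a subset of `Ω₂`. -/
def Omega3 : Set (Omega2 k) := {c | (c : Quotient (tau k)) ∈ tauClass k '' setJ k}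

end Brauer

/-! An element of the Brauer monoid is a fixed-point-free involution `mate` on the two rows, and `α
≤ β` in the `R`-order exactly when every upper block of `β` is a block of `α` (`greenRLe_iff`).
Hence `K` consists of the elements whose upper blocks all have the form `{i, buddy i}`. On `J` the
two transversals, if any, start at neighbours, so multiplying by `ζ` on the left closes them just as
`hat` does: on `J`, `τ` says that `ζ * α = ζ * β`. This makes the right congruence and the
isomorphism `ξ` (with inverse `[α] ↦ ζ * α`) easy to check.

Faithfulness: the elements of `R_γ` detect all lower blocks and transversals, as their two
transversals can be led to any two points (`mate_inr_eq_of_gamma`). Then only upper blocks can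
differ. If `σ` has `{a,b}` and `{c,d}` but `θ` has `{b,c}`, an element of rank four that leads two
pairs of neighbours to `a,b` and `c,d` moves `σ` into `K` but not `θ` (`mate_inl_eq_of_tau`).

Counting: projections of rank `r` correspond to involutions with `r` fixed points, through the lower
pattern `low` (`numProj_eq`). An element `α` of `K` is determined up to `U` by `low α` and by the
pairing `low (ζ * α)` that extends it (`exists_mem_stabU_iff`). Four fixed points can be paired in
three ways, which gives `3 * p₄` classes of rank four. On `J` only the pairing counts, which gives
`p₀`; the complement of `K` is one class. Finally `R_γ` has `2 * p₂` elements: a pattern with two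
fixed points, and an order of these. -/

namespace Partn

/-! ### Short paths in the product graph -/

variable {n : ℕ} {α β : Partn n} {i j l m : Fin n}

/-- Paths of at most three edges. The blocks of all products below are traced through these five
kinds of path. -/
theorem mul_rel_upper (h : α.Rel (.inl i) (.inl j)) : (α * β).Rel (.inl i) (.inl j) :=
  mul_rel.2 (.rel _ _ (.top h))

theorem mul_rel_lower (h : β.Rel (.inr i) (.inr j)) : (α * β).Rel (.inr i) (.inr j) :=
  mul_rel.2 (.rel _ _ (.bot h))

theorem mul_rel_through (h : α.Rel (.inl i) (.inr l)) (h' : β.Rel (.inl l) (.inr j)) :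
    (α * β).Rel (.inl i) (.inr j) :=
  mul_rel.2 (.trans _ _ _ (.rel _ _ (.top h)) (.rel _ _ (.bot h')))

theorem mul_rel_cap (h : α.Rel (.inl i) (.inr l)) (h' : β.Rel (.inl l) (.inl m))
    (h'' : α.Rel (.inl j) (.inr m)) : (α * β).Rel (.inl i) (.inl j) :=
  mul_rel.2 (.trans _ _ _ (.rel _ _ (.top h)) (.trans _ _ _ (.rel _ _ (.bot h'))
    (.rel _ _ (.top h''.symm))))

theorem mul_rel_cup (h : β.Rel (.inl l) (.inr i)) (h' : α.Rel (.inr l) (.inr m))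
    (h'' : β.Rel (.inl m) (.inr j)) : (α * β).Rel (.inr i) (.inr j) :=
  mul_rel.2 (.trans _ _ _ (.rel _ _ (.bot h.symm)) (.trans _ _ _ (.rel _ _ (.top h'))
    (.rel _ _ (.bot h''))))

end Partn

/-! ### Elements of the Brauer monoid as involutions, and the `R`-order -/

namespace Brauer

variable {n : ℕ}

/-- The other vertex of the block of a vertex. -/
noncomputable def mate (α : Brauer n) : Fin n ⊕ Fin n → Fin n ⊕ Fin n :=
  (Partn.allPairs_iff.1 α.2).choose

theorem mate_ne (α : Brauer n) (x) : mate α x ≠ x :=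
  (Partn.allPairs_iff.1 α.2).choose_spec.1 x

@[simp] theorem mate_mate (α : Brauer n) (x) : mate α (mate α x) = x :=
  (Partn.allPairs_iff.1 α.2).choose_spec.2.1 x

theorem rel_iff {α : Brauer n} {x y} : (α : Partn n).Rel x y ↔ y = x ∨ y = mate α x :=
  (Partn.allPairs_iff.1 α.2).choose_spec.2.2 x y

theorem rel_iff_of_ne {α : Brauer n} {x y} (h : y ≠ x) :
    (α : Partn n).Rel x y ↔ mate α x = y := by
  rw [rel_iff, or_iff_right h, eq_comm]

theorem rel_mate (α : Brauer n) (x) : (α : Partn n).Rel x (mate α x) := rel_iff.2 (.inr rfl)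

theorem rel_of_mate {α : Brauer n} {x y} (h : mate α x = y) : (α : Partn n).Rel x y :=
  h ▸ rel_mate α x

theorem mate_eq_comm {α : Brauer n} {x y} : mate α x = y ↔ mate α y = x :=
  ⟨fun h => h ▸ mate_mate α x, fun h => h ▸ mate_mate α y⟩

theorem rel_inl_inr {α : Brauer n} {i j} :
    (α : Partn n).Rel (.inl i) (.inr j) ↔ mate α (.inl i) = .inr j := rel_iff_of_ne (by simp)

theorem rel_inr_inl {α : Brauer n} {i j} :
    (α : Partn n).Rel (.inr i) (.inl j) ↔ mate α (.inr i) = .inl j := rel_iff_of_ne (by simp)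

/-- No perfect matching properly contains another one, so one inclusion is enough. -/
theorem ext_of_mate_rel {α β : Brauer n} (h : ∀ x, (β : Partn n).Rel x (mate α x)) : α = β := by
  have h' : ∀ x, mate β x = mate α x := fun x => (rel_iff_of_ne (mate_ne α x)).1 (h x)
  apply Subtype.ext
  ext x y
  rw [rel_iff, rel_iff, h']

theorem ext_mate {α β : Brauer n} (h : ∀ x, mate α x = mate β x) : α = β :=
  ext_of_mate_rel fun x => h x ▸ rel_mate β x

theorem mate_injective : Function.Injective (mate : Brauer n → _) :=
  fun _ _ h => ext_mate (congrFun h)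

instance : Finite (Brauer n) := Finite.of_injective _ mate_injective

/-- The element of the Brauer monoid with a given involution. -/
def ofMate (a : Fin n ⊕ Fin n → Fin n ⊕ Fin n) (h : ∀ x, a x ≠ x) (h' : ∀ x, a (a x) = x) :
    Brauer n :=
  ⟨(⟨fun x y => y = x ∨ y = a x, fun _ => .inl rfl, by
      rintro x y (rfl | rfl)
      · exact .inl rfl
      · exact .inr (h' x).symm, by
      rintro x y z (rfl | rfl) (rfl | rfl)
      · exact .inl rfl
      · exact .inr rfl
      · exact .inr rfl
      · exact .inl (h' x)⟩ : Setoid _), Partn.allPairs_iff.2 ⟨a, h, h', fun _ _ => Iff.rfl⟩⟩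

@[simp] theorem mate_ofMate (a : Fin n ⊕ Fin n → Fin n ⊕ Fin n) (h h') (x) :
    mate (ofMate a h h') x = a x := by
  rw [← rel_iff_of_ne (h x)]
  exact .inr rfl

/-- Interchanging the two rows. -/
noncomputable def star (α : Brauer n) : Brauer n :=
  ⟨(α : Partn n).star, Partn.allPairs_iff.2 ⟨fun x => (mate α x.swap).swap,
    fun x h => mate_ne α x.swap (Sum.swap_rightInverse.injective (by simpa using h)), by simp, fun x y => by
      rw [Partn.star_rel, rel_iff, Sum.swap_rightInverse.injective.eq_iff,
        ← Sum.swap_swap (mate α x.swap), Sum.swap_rightInverse.injective.eq_iff]⟩⟩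

@[simp] theorem coe_star (α : Brauer n) : (star α : Partn n) = (α : Partn n).star := rfl

theorem star_mul (α β : Brauer n) : star (α * β) = star β * star α :=
  Subtype.ext (Partn.star_mul _ _)

@[simp] theorem mate_star (α : Brauer n) (x) : mate (star α) x = (mate α x.swap).swap := by
  rw [← rel_iff_of_ne (fun h => mate_ne α x.swap (Sum.swap_rightInverse.injective (by simpa using h))), coe_star, Partn.star_rel,
    Sum.swap_swap]
  exact rel_mate α _

theorem mate_inl_cases (α : Brauer n) (i) :
    (∃ j, mate α (.inl i) = .inl j) ∨ ∃ j, mate α (.inl i) = .inr j := by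
  rcases mate α (.inl i) with j | j <;> simp

theorem mate_inr_cases (α : Brauer n) (i) :
    (∃ j, mate α (.inr i) = .inr j) ∨ ∃ j, mate α (.inr i) = .inl j := by
  rcases mate α (.inr i) with j | j <;> simp

section Mul

variable {α β : Brauer n} {i j l m : Fin n}

theorem mate_ne_inl (h : mate α (.inl i) = .inl j) : i ≠ j := by
  rintro rfl; exact mate_ne _ _ h

theorem mate_ne_inr (h : mate α (.inr i) = .inr j) : i ≠ j := by
  rintro rfl; exact mate_ne _ _ h

theorem mate_mul_upper (h : mate α (.inl i) = .inl j) : mate (α * β) (.inl i) = .inl j :=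
  (rel_iff_of_ne (by simpa using (mate_ne_inl h).symm)).1 (Partn.mul_rel_upper (rel_of_mate h))

theorem mate_mul_lower (h : mate β (.inr i) = .inr j) : mate (α * β) (.inr i) = .inr j :=
  (rel_iff_of_ne (by simpa using (mate_ne_inr h).symm)).1 (Partn.mul_rel_lower (rel_of_mate h))

theorem mate_mul_through (h : mate α (.inl i) = .inr l) (h' : mate β (.inl l) = .inr j) :
    mate (α * β) (.inl i) = .inr j :=
  rel_inl_inr.1 (Partn.mul_rel_through (rel_of_mate h) (rel_of_mate h'))

theorem mate_mul_cap (h : mate α (.inl i) = .inr l) (h' : mate β (.inl l) = .inl m)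
    (h'' : mate α (.inl j) = .inr m) : mate (α * β) (.inl i) = .inl j := by
  have hij : j ≠ i := by
    rintro rfl
    exact mate_ne_inl h' (by simpa using h.symm.trans h'')
  exact (rel_iff_of_ne (by simpa using hij)).1
    (Partn.mul_rel_cap (rel_of_mate h) (rel_of_mate h') (rel_of_mate h''))

theorem mate_mul_cup (h : mate β (.inl l) = .inr i) (h' : mate α (.inr l) = .inr m)
    (h'' : mate β (.inl m) = .inr j) : mate (α * β) (.inr i) = .inr j := by
  have hij : j ≠ i := by
    rintro rfl
    rw [mate_eq_comm] at h h''
    exact mate_ne_inr h' (by simpa using h.symm.trans h'')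
  exact (rel_iff_of_ne (by simpa using hij)).1
    (Partn.mul_rel_cup (rel_of_mate h) (rel_of_mate h') (rel_of_mate h''))

end Mul

/-- An element is below another one in the `R`-order if it contains its upper blocks. -/
theorem eq_mul_star_mul {α β : Brauer n}
    (h : ∀ i j, mate β (.inl i) = .inl j → mate α (.inl i) = .inl j) :
    α = β * (star β * α) := by
  rw [← mul_assoc]
  -- `β * star β` keeps the upper blocks of `β` and has `{i, i'}` at every other `i`.
  have hb : ∀ i, (∃ j, mate β (.inl i) = .inl j) ∨
      mate (β * star β) (.inl i) = .inr i := by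
    intro i
    rcases mate_inl_cases β i with ⟨j, hj⟩ | ⟨j, hj⟩
    · exact .inl ⟨j, hj⟩
    · exact .inr (mate_mul_through hj (by simp [mate_eq_comm.1 hj]))
  refine ext_mate fun x => ?_
  rcases x with i | i
  · rcases hb i with ⟨j, hj⟩ | hi
    · rw [h _ _ hj, mate_mul_upper (mate_mul_upper hj)]
    · rcases mate_inl_cases α i with ⟨j, hj⟩ | ⟨j, hj⟩
      · rw [hj]
        -- An upper block of `β` at `j` is also a block of `α`, so it can only be `{i, j}`.
        rcases hb j with ⟨l, hl⟩ | hj'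
        · have h2 := h _ _ hl
          rw [mate_eq_comm.1 hj] at h2
          rw [← h2, mate_eq_comm] at hl
          rw [mate_mul_upper (mate_mul_upper hl)]
        · rw [mate_mul_cap hi hj hj']
      · rw [hj, mate_mul_through hi hj]
  · rcases mate_inr_cases α i with ⟨j, hj⟩ | ⟨j, hj⟩
    · rw [hj, mate_mul_lower hj]
    · rw [hj]
      rw [mate_eq_comm] at hj
      rcases hb j with ⟨l, hl⟩ | hj'
      · rw [h _ _ hl] at hj
        simp at hj
      · rw [eq_comm, mate_eq_comm, mate_mul_through hj' hj]

theorem greenRLe_iff {α β : Brauer n} : GreenRLe α β ↔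
    ∀ i j, mate β (.inl i) = .inl j → mate α (.inl i) = .inl j := by
  constructor
  · rintro ⟨s, rfl⟩ i j h
    exact mate_mul_upper h
  · intro h
    exact ⟨_, eq_mul_star_mul h⟩

theorem GreenRLe.of_mul {S : Type} [Monoid S] {a b s : S} (h : GreenRLe a (b * s)) :
    GreenRLe a b := by
  obtain ⟨t, rfl⟩ := h
  exact ⟨s * t, mul_assoc _ _ _⟩

/-- The upper blocks of `u` persist in `u * u⁻¹ = 1`, so `1` is below `u` in the `R`-order, with
`star u` as a right inverse. For a unit this is the inverse. -/
theorem star_mul_self_of_isUnit {u : Brauer n} (h : IsUnit u) : star u * u = 1 := by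
  obtain ⟨u, rfl⟩ := h
  have h1 : (1 : Brauer n) = u * (star u.val * 1) := by
    refine eq_mul_star_mul fun i j hij => ?_
    rw [← u.mul_inv]
    exact mate_mul_upper hij
  have h2 := Units.inv_eq_of_mul_eq_one_right (by simpa using h1.symm)
  rw [← h2, Units.inv_mul]

/-! ### The rank -/

/-- The upper vertices of the transversals. -/
def upperSet (α : Brauer n) : Set (Fin n) := {i | ∃ j, mate α (.inl i) = .inr j}

/-- The lower vertices of the transversals. -/
def lowerSet (α : Brauer n) : Set (Fin n) := {i | ∃ j, mate α (.inr i) = .inl j}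

/-- Transversals may be counted by their upper or by their lower ends; `f` chooses the row. -/
theorem rank_eq_of_embedding (α : Brauer n) (s : Set (Fin n)) (f : Fin n → Fin n ⊕ Fin n)
    (hf : ∀ i ∈ s, ∀ j ∈ s, f j ≠ mate α (f i)) (hf' : Function.Injective f)
    (hs : ∀ i ∈ s, (f i).isLeft ≠ (mate α (f i)).isLeft)
    (hs' : ∀ i j, mate α (.inl i) = .inr j → ∃ l ∈ s, f l = .inl i ∨ f l = .inr j) :
    (α : Partn n).rank = s.ncard := by
  unfold Partn.rank
  symm
  refine Set.ncard_congr (fun i _ => {y | (α : Partn n).Rel (f i) y}) ?_ ?_ ?_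
  · intro i hi
    refine ⟨⟨f i, ?_⟩, ?_⟩
    · ext y
      exact ⟨fun h => Partn.Rel.symm h, fun h => Partn.Rel.symm h⟩
    · have h1 := hs i hi
      have h2 := rel_mate α (f i)
      rcases h3 : f i with a | a <;> rcases h4 : mate α (f i) with b | b <;>
        rw [h3] at h1 h2 <;> rw [← h3, h4, h3] at h1 <;> rw [← h3, h4, h3] at h2
      · simp at h1
      · exact ⟨⟨a, Partn.Rel.refl _ _⟩, b, h2⟩
      · exact ⟨⟨b, h2⟩, a, Partn.Rel.refl _ _⟩
      · simp at h1
  · intro i j hi hj h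
    have h1 : f j ∈ {y | (α : Partn n).Rel (f i) y} := by
      rw [h]; exact Partn.Rel.refl _ _
    rcases rel_iff.1 h1 with h2 | h2
    · exact hf' h2.symm
    · exact absurd h2 (hf i hi j hj)
  · rintro C ⟨⟨y, rfl⟩, ⟨i, hi⟩, ⟨j, hj⟩⟩
    have hij : (α : Partn n).Rel (.inl i) (.inr j) := Partn.Rel.trans hi (Partn.Rel.symm hj)
    obtain ⟨l, hl, h⟩ := hs' i j (rel_inl_inr.1 hij)
    have h2 : (α : Partn n).Rel (f l) y := by
      rcases h with h | h <;> rw [h]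
      · exact hi
      · exact hj
    refine ⟨l, hl, ?_⟩
    ext z
    exact ⟨fun h => Partn.Rel.trans (Partn.Rel.symm h) h2,
      fun h => Partn.Rel.trans h2 (Partn.Rel.symm h)⟩

theorem rank_eq_upperSet (α : Brauer n) : (α : Partn n).rank = (upperSet α).ncard := by
  refine rank_eq_of_embedding α _ Sum.inl ?_ Sum.inl_injective ?_ ?_
  · rintro i ⟨l, hl⟩ j -
    simp [hl]
  · rintro i ⟨l, hl⟩
    simp [hl]
  · intro i j h
    exact ⟨i, ⟨j, h⟩, .inl rfl⟩

theorem rank_eq_lowerSet (α : Brauer n) : (α : Partn n).rank = (lowerSet α).ncard := by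
  refine rank_eq_of_embedding α _ Sum.inr ?_ Sum.inr_injective ?_ ?_
  · rintro i ⟨l, hl⟩ j -
    simp [hl]
  · rintro i ⟨l, hl⟩
    simp [hl]
  · intro i j h
    exact ⟨j, ⟨i, mate_eq_comm.1 h⟩, .inr rfl⟩

theorem rank_mul_le_left (α β : Brauer n) :
    ((α * β : Brauer n) : Partn n).rank ≤ (α : Partn n).rank := by
  rw [rank_eq_upperSet, rank_eq_upperSet]
  refine Set.ncard_le_ncard ?_
  rintro i ⟨j, hj⟩
  rcases mate_inl_cases α i with ⟨l, hl⟩ | h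
  · rw [mate_mul_upper hl] at hj
    simp at hj
  · exact h

theorem rank_mul_le_right (α β : Brauer n) :
    ((α * β : Brauer n) : Partn n).rank ≤ (β : Partn n).rank := by
  rw [rank_eq_lowerSet, rank_eq_lowerSet]
  refine Set.ncard_le_ncard ?_
  rintro i ⟨j, hj⟩
  rcases mate_inr_cases β i with ⟨l, hl⟩ | h
  · rw [mate_mul_lower hl] at hj
    simp at hj
  · exact h

/-! ### Lower patterns, projections and permutations -/

/-- The involution given by the lower blocks; its fixed points are the lower vertices of the
transversals. -/
noncomputable def low (α : Brauer n) (i : Fin n) : Fin n :=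
  Sum.elim (fun _ => i) id (mate α (.inr i))

theorem low_eq {α : Brauer n} {i j} (h : mate α (.inr i) = .inr j) : low α i = j := by
  simp [low, h]

theorem low_eq_self_iff {α : Brauer n} {i} : low α i = i ↔ i ∈ lowerSet α := by
  rcases mate_inr_cases α i with ⟨j, hj⟩ | ⟨j, hj⟩
  · simp [low, lowerSet, hj, (mate_ne_inr hj).symm]
  · simp [low, lowerSet, hj]

theorem mate_inr_eq_low {α : Brauer n} {i} (h : i ∉ lowerSet α) :
    mate α (.inr i) = .inr (low α i) := by
  rcases mate_inr_cases α i with ⟨j, hj⟩ | hj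
  · rw [low_eq hj, hj]
  · exact absurd hj h

theorem low_involutive (α : Brauer n) : Function.Involutive (low α) := by
  intro i
  by_cases h : i ∈ lowerSet α
  · rw [low_eq_self_iff.2 h, low_eq_self_iff.2 h]
  · exact low_eq (mate_eq_comm.1 (mate_inr_eq_low h))

theorem mate_eq_of_low_ne {α : Brauer n} {i} (h : low α i ≠ i) :
    mate α (.inr i) = .inr (low α i) := mate_inr_eq_low (mt low_eq_self_iff.2 h)

/-- The involutions with a given number of fixed points. -/
def Pattern (n r : ℕ) : Type :=
  {f : Fin n → Fin n // Function.Involutive f ∧ (Function.fixedPoints f).ncard = r}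

theorem fixedPoints_low (α : Brauer n) : Function.fixedPoints (low α) = lowerSet α := by
  ext i
  exact low_eq_self_iff

/-- The projection with a given lower pattern. -/
def proj (f : Fin n → Fin n) (hf : Function.Involutive f) : Brauer n :=
  ofMate (fun x => if Sum.elim f f x = Sum.elim id id x then x.swap else Sum.map f f x)
    (by rintro (i | i) <;> by_cases h : f i = i <;> simp [h])
    (by
      have hf' : ∀ i, f i ≠ i → i ≠ f i := fun i h => h.symm
      rintro (i | i) <;> by_cases h : f i = i
      · simp [h]
      · simp [h, hf i, hf' i h]
      · simp [h]
      · simp [h, hf i, hf' i h])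

section Proj

variable {f : Fin n → Fin n} {hf : Function.Involutive f} {i : Fin n}

theorem mate_proj_inl_self (h : f i = i) : mate (proj f hf) (.inl i) = .inr i := by
  simp [proj, h]

theorem mate_proj_inr_self (h : f i = i) : mate (proj f hf) (.inr i) = .inl i := by
  simp [proj, h]

theorem mate_proj_inl (h : f i ≠ i) : mate (proj f hf) (.inl i) = .inl (f i) := by
  simp [proj, h]

theorem mate_proj_inr (h : f i ≠ i) : mate (proj f hf) (.inr i) = .inr (f i) := by
  simp [proj, h]

theorem low_proj : low (proj f hf) = f := by
  ext i
  by_cases h : f i = i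
  · simp [low, mate_proj_inr_self h, h]
  · simp [low, mate_proj_inr h]

theorem rank_proj : (proj f hf : Partn n).rank = (Function.fixedPoints f).ncard := by
  rw [rank_eq_lowerSet, ← fixedPoints_low, low_proj]

theorem star_proj : star (proj f hf) = proj f hf := by
  refine ext_mate ?_
  rintro (i | i) <;> by_cases h : f i = i <;> simp [proj, h]

theorem proj_mul_proj : proj f hf * proj f hf = proj f hf := by
  symm
  refine ext_mate ?_
  rintro (i | i) <;> by_cases h : f i = i
  · rw [mate_proj_inl_self h, mate_mul_through (mate_proj_inl_self h) (mate_proj_inl_self h)]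
  · rw [mate_proj_inl h, mate_mul_upper (mate_proj_inl h)]
  · rw [mate_proj_inr_self h, eq_comm, mate_eq_comm,
      mate_mul_through (mate_proj_inl_self h) (mate_proj_inl_self h)]
  · rw [mate_proj_inr h, mate_mul_lower (mate_proj_inr h)]

end Proj

/-- Along with a transversal `{j, i'}` its mirror image `{i, j'}` is a block, so `ε * ε` contains
`{i, i'}`; idempotency then forces `j = i`. The upper blocks mirror the lower ones. -/
theorem proj_low_of_projection {ε : Brauer n} (h : ε * ε = ε) (h' : star ε = ε) :
    proj (low ε) (low_involutive ε) = ε := by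
  have hs : ∀ x, mate ε x = (mate ε x.swap).swap := fun x => by rw [← mate_star, h']
  have hinr : ∀ i, mate (proj (low ε) (low_involutive ε)) (.inr i) = mate ε (.inr i) := by
    intro i
    by_cases hi : low ε i = i
    · rw [mate_proj_inr_self hi]
      obtain ⟨j, hj⟩ := low_eq_self_iff.1 hi
      have h1 : mate ε (.inl i) = .inr j := by simp [hs (.inl i), hj]
      have h2 : mate ε (.inl j) = .inr i := mate_eq_comm.1 hj
      have h3 := mate_mul_through h1 h2
      rw [h, mate_eq_comm] at h3
      exact h3.symm
    · rw [mate_proj_inr hi, mate_eq_of_low_ne hi]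
  refine ext_mate ?_
  rintro (i | i)
  · rw [hs, ← star_proj, mate_star, Sum.swap_inl, hinr]
  · exact hinr i

theorem numProj_eq (n r : ℕ) : numProj n r = Nat.card (Pattern n r) := by
  refine Nat.card_congr ⟨fun ε => ⟨low ε.1, low_involutive _, ?_⟩, fun f => ⟨proj f.1 f.2.1, ?_⟩,
    ?_, ?_⟩
  · rw [fixedPoints_low, ← rank_eq_lowerSet, ε.2.2.2]
  · exact ⟨proj_mul_proj, congrArg Subtype.val star_proj, by rw [rank_proj, f.2.2]⟩
  · rintro ⟨ε, h1, h2, h3⟩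
    exact Subtype.ext (proj_low_of_projection h1 (Subtype.ext h2))
  · rintro ⟨f, hf, h⟩
    exact Subtype.ext (low_proj (hf := hf))

/-- The unit with the blocks `{i, (π i)'}`. -/
def ofPerm (π : Equiv.Perm (Fin n)) : Brauer n :=
  ofMate (Sum.elim (fun i => .inr (π i)) (fun i => .inl (π.symm i)))
    (by rintro (i | i) <;> simp) (by rintro (i | i) <;> simp)

@[simp] theorem mate_ofPerm_inl (π : Equiv.Perm (Fin n)) (i) :
    mate (ofPerm π) (.inl i) = .inr (π i) := by simp [ofPerm]

@[simp] theorem mate_ofPerm_inr (π : Equiv.Perm (Fin n)) (i) :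
    mate (ofPerm π) (.inr i) = .inl (π.symm i) := by simp [ofPerm]

/-- The factors change places because partitions compose from left to right and permutations from
right to left. -/
theorem ofPerm_mul (π ρ : Equiv.Perm (Fin n)) : ofPerm π * ofPerm ρ = ofPerm (ρ * π) := by
  symm
  have h : ∀ i, mate (ofPerm π * ofPerm ρ) (.inl i) = .inr (ρ (π i)) := fun i =>
    mate_mul_through (mate_ofPerm_inl π i) (mate_ofPerm_inl ρ _)
  refine ext_mate ?_
  rintro (i | i)
  · rw [h, mate_ofPerm_inl]
    rfl
  · rw [eq_comm, mate_eq_comm, mate_ofPerm_inr, h]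
    exact congrArg Sum.inr ((ρ * π).apply_symm_apply i)

theorem ofPerm_one : ofPerm (1 : Equiv.Perm (Fin n)) = 1 := by
  refine ext_of_mate_rel ?_
  rintro (i | i)
  · simp [Partn.one_rel]
  · rw [mate_ofPerm_inr]
    exact Partn.one_rel.2 rfl

theorem isUnit_ofPerm (π : Equiv.Perm (Fin n)) : IsUnit (ofPerm π) :=
  ⟨⟨ofPerm π, ofPerm π⁻¹, by rw [ofPerm_mul, inv_mul_cancel, ofPerm_one],
    by rw [ofPerm_mul, mul_inv_cancel, ofPerm_one]⟩, rfl⟩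

end Brauer
namespace Brauer

variable {k : ℕ}

/-! ### The elements `ζ` and `γ` -/

theorem mate_zeta_inl (i : Fin (2 * k)) : mate (zeta k) (.inl i) = .inl (buddy i) := by
  rw [← rel_iff_of_ne (by simp [buddy_ne])]
  refine (zetaPartn_rel k).2 (Prod.ext rfl ?_)
  exact (half_eq_iff i (buddy i)).2 (.inr rfl)

theorem mate_zeta_inr (i : Fin (2 * k)) : mate (zeta k) (.inr i) = .inr (buddy i) := by
  rw [← rel_iff_of_ne (by simp [buddy_ne])]
  refine (zetaPartn_rel k).2 (Prod.ext rfl ?_)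
  exact (half_eq_iff i (buddy i)).2 (.inr rfl)

theorem mate_gamma_inl {i : Fin (2 * k)} (h : (i : ℕ) < 2) :
    mate (gamma k) (.inl i) = .inr i := by
  rw [← rel_inl_inr]
  refine (gammaPartn_rel k).2 ?_
  simp [pos, h]

theorem buddy_lt_two {i : Fin (2 * k)} : (buddy i : ℕ) < 2 ↔ (i : ℕ) < 2 := by
  have : (buddy i : ℕ) / 2 = i / 2 := ((half_eq_iff i _).2 (.inr rfl)).symm
  omega

theorem mate_gamma_inl_of_le {i : Fin (2 * k)} (h : ¬ (i : ℕ) < 2) :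
    mate (gamma k) (.inl i) = .inl (buddy i) := by
  rw [← rel_iff_of_ne (by simp [buddy_ne])]
  refine (gammaPartn_rel k).2 ?_
  simp only [pos, Sum.elim_inl, h, buddy_lt_two, if_false, Sum.isLeft_inl]
  rw [(half_eq_iff i (buddy i)).2 (.inr rfl)]

theorem mem_setK {α : Brauer (2 * k)} :
    α ∈ setK k ↔ ∀ i j, mate α (.inl i) = .inl j → j = buddy i := by
  refine greenRLe_iff.trans ?_
  simp only [mate_zeta_inl, Sum.inl.injEq, eq_comm]

theorem zeta_mul_zeta : zeta k * zeta k = zeta k := by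
  symm
  refine ext_mate ?_
  rintro (i | i)
  · rw [mate_zeta_inl, mate_mul_upper (mate_zeta_inl i)]
  · rw [mate_zeta_inr, mate_mul_lower (mate_zeta_inr i)]

theorem star_zeta : star (zeta k) = zeta k := by
  refine ext_mate ?_
  rintro (i | i) <;> simp [mate_zeta_inl, mate_zeta_inr]

theorem rank_zeta : (zeta k : Partn (2 * k)).rank = 0 := by
  rw [rank_eq_upperSet, Set.ncard_eq_zero]
  ext i
  simp [upperSet, mate_zeta_inl]

theorem mate_zeta_mul_inl (α : Brauer (2 * k)) (i) :
    mate (zeta k * α) (.inl i) = .inl (buddy i) := mate_mul_upper (mate_zeta_inl i)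

theorem mate_zeta_mul_inr (α : Brauer (2 * k)) (i) :
    mate (zeta k * α) (.inr i) = .inr (low (zeta k * α) i) := by
  refine mate_inr_eq_low ?_
  rintro ⟨j, hj⟩
  rw [mate_eq_comm, mate_zeta_mul_inl] at hj
  simp at hj

theorem low_zeta_mul_ne (α : Brauer (2 * k)) (i) : low (zeta k * α) i ≠ i :=
  (mate_ne_inr (mate_zeta_mul_inr α i)).symm

theorem zeta_mul_eq_zeta_mul_iff {α β : Brauer (2 * k)} :
    zeta k * α = zeta k * β ↔ low (zeta k * α) = low (zeta k * β) := by
  refine ⟨fun h => h ▸ rfl, fun h => ext_mate ?_⟩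
  rintro (i | i)
  · rw [mate_zeta_mul_inl, mate_zeta_mul_inl]
  · rw [mate_zeta_mul_inr, mate_zeta_mul_inr, h]

/-- In `K` the only upper block possible at `buddy i` is the one with `i`, but `i` is on a
transversal. -/
theorem exists_mate_buddy {α : Brauer (2 * k)} (hα : α ∈ setK k) {i j}
    (h : mate α (.inl i) = .inr j) : ∃ l, mate α (.inl (buddy i)) = .inr l := by
  rcases mate_inl_cases α (buddy i) with ⟨l, hl⟩ | h'
  · have := mem_setK.1 hα _ _ hl
    rw [buddy_buddy] at this
    subst this
    rw [mate_eq_comm, h] at hl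
    simp at hl
  · exact h'

theorem low_zeta_mul_of_ne {α : Brauer (2 * k)} {i} (h : low α i ≠ i) :
    low (zeta k * α) i = low α i := low_eq (mate_mul_lower (mate_eq_of_low_ne h))

theorem low_zeta_mul_eq {α : Brauer (2 * k)} {i j l} (h : mate α (.inl i) = .inr j)
    (h' : mate α (.inl (buddy i)) = .inr l) : low (zeta k * α) j = l :=
  low_eq (mate_mul_cup h (mate_zeta_inr i) h')

theorem isTransversal_inl {n : ℕ} {α : Brauer n} {i} :
    IsTransversal (α : Partn n) (.inl i) ↔ i ∈ upperSet α := by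
  constructor
  · rintro ⟨j | j, h, h'⟩
    · simp at h'
    · exact ⟨j, rel_inl_inr.1 h⟩
  · rintro ⟨j, h⟩
    exact ⟨_, rel_inl_inr.2 h, by simp⟩

theorem isTransversal_inr {n : ℕ} {α : Brauer n} {i} :
    IsTransversal (α : Partn n) (.inr i) ↔ i ∈ lowerSet α := by
  constructor
  · rintro ⟨j | j, h, h'⟩
    · exact ⟨j, rel_inr_inl.1 h⟩
    · simp at h'
  · rintro ⟨j, h⟩
    exact ⟨_, rel_inr_inl.2 h, by simp⟩

/-- The upper ends of the transversals are closed under `buddy`, and there are at most two of them.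
-/
theorem eq_buddy_of_mem_setJ {α : Brauer (2 * k)} (hα : α ∈ setJ k) {i j}
    (hi : i ∈ upperSet α) (hj : j ∈ upperSet α) (hij : j ≠ i) : j = buddy i := by
  have h1 : ({i, buddy i} : Set _) ⊆ upperSet α := by
    rintro l (rfl | rfl)
    · exact hi
    · exact exists_mate_buddy hα.2 hi.choose_spec
  have h2 := Set.eq_of_subset_of_ncard_le h1 (by
    rw [Set.ncard_pair (buddy_ne i).symm, ← rank_eq_upperSet]; exact hα.1)
  rw [← h2] at hj
  exact hj.resolve_left hij

/-- The transversals of `α` start at two neighbours, and the lower block of `ζ` on these joins their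
lower ends. The upper row of both sides consists of the pairs of neighbours. -/
theorem hat_eq_zeta_mul {α : Brauer (2 * k)} (hα : α ∈ setJ k) :
    hat (α : Partn (2 * k)) = (zeta k * α : Brauer (2 * k)) := by
  have h1 : ∀ x y, x ≠ y → (hat (α : Partn (2 * k))).Rel x y →
      ((zeta k * α : Brauer (2 * k)) : Partn (2 * k)).Rel x y := by
    rintro (i | i) (j | j) hij ⟨hl, h⟩ <;> simp at hl
    · refine rel_of_mate ((mate_zeta_mul_inl α i).trans (congrArg _ ?_))
      rcases h with h | ⟨h, h'⟩
      · exact (mem_setK.1 hα.2 _ _ ((rel_iff_of_ne hij.symm).1 h)).symm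
      · exact (eq_buddy_of_mem_setJ hα (isTransversal_inl.1 h) (isTransversal_inl.1 h')
          (by rintro rfl; exact hij rfl)).symm
    · rcases h with h | ⟨h, h'⟩
      · exact Partn.mul_rel_lower h
      · obtain ⟨a, ha⟩ := isTransversal_inr.1 h
        obtain ⟨b, hb⟩ := isTransversal_inr.1 h'
        rw [mate_eq_comm] at ha hb
        have := eq_buddy_of_mem_setJ hα ⟨_, ha⟩ ⟨_, hb⟩ (by
          rintro rfl
          exact hij (ha.symm.trans hb))
        subst this
        exact rel_of_mate (mate_mul_cup ha (mate_zeta_inr a) hb)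
  -- `hat α` has not been shown to be a matching. As it lies inside the matching `ζ * α`, a partner
  -- for every vertex makes the two equal.
  have h2 : ∀ x, ∃ y, x ≠ y ∧ (hat (α : Partn (2 * k))).Rel x y := by
    rintro (i | i)
    · rcases mate_inl_cases α i with ⟨j, hj⟩ | ⟨j, hj⟩
      · exact ⟨.inl j, by simpa using mate_ne_inl hj, rfl, .inl (rel_of_mate hj)⟩
      · exact ⟨.inl (buddy i), by simpa using (buddy_ne i).symm, rfl,
          .inr ⟨isTransversal_inl.2 ⟨j, hj⟩, isTransversal_inl.2 (exists_mate_buddy hα.2 hj)⟩⟩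
    · rcases mate_inr_cases α i with ⟨j, hj⟩ | ⟨j, hj⟩
      · exact ⟨.inr j, by simpa using mate_ne_inr hj, rfl, .inl (rel_of_mate hj)⟩
      · have hj' := mate_eq_comm.1 hj
        obtain ⟨l, hl⟩ := exists_mate_buddy hα.2 hj'
        refine ⟨.inr l, ?_, rfl, .inr ⟨isTransversal_inr.2 ⟨j, hj⟩,
          isTransversal_inr.2 ⟨_, mate_eq_comm.1 hl⟩⟩⟩
        rintro h
        rw [← h, ← hj'] at hl
        have := congrArg (mate α) hl
        simp [buddy_ne] at this
  ext x y
  by_cases hxy : x = y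
  · subst hxy
    exact ⟨fun _ => Partn.Rel.refl _ _, fun _ => Partn.Rel.refl _ _⟩
  refine ⟨h1 x y hxy, fun h => ?_⟩
  obtain ⟨z, hz, hz'⟩ := h2 x
  have := h1 x z hz hz'
  rw [rel_iff_of_ne (Ne.symm hz)] at this
  rw [rel_iff_of_ne (Ne.symm hxy), this] at h
  exact h ▸ hz'

theorem chi_iff {α β : Brauer (2 * k)} (hα : α ∈ setJ k) (hβ : β ∈ setJ k) :
    chi (2 * k) α β ↔ zeta k * α = zeta k * β := by
  constructor
  · rintro (rfl | ⟨-, -, h⟩)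
    · rfl
    · rw [hat_eq_zeta_mul hα, hat_eq_zeta_mul hβ] at h
      exact Subtype.ext h
  · intro h
    exact .inr ⟨hα.1, hβ.1, by rw [hat_eq_zeta_mul hα, hat_eq_zeta_mul hβ, h]⟩

/-- The upper blocks of `α` persist. A new one can only join the upper ends of the two transversals
of `α`, which are neighbours. -/
theorem mul_mem_setJ {α : Brauer (2 * k)} (hα : α ∈ setJ k) (θ : Brauer (2 * k)) :
    α * θ ∈ setJ k := by
  refine ⟨(rank_mul_le_left _ _).trans hα.1, mem_setK.2 fun i j hij => ?_⟩
  have h : ∀ i j, mate (α * θ) (.inl i) = .inl j → i ∉ upperSet α → j = buddy i := by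
    intro i j hij hi
    rcases mate_inl_cases α i with ⟨l, hl⟩ | h
    · rw [mate_mul_upper hl] at hij
      obtain rfl := Sum.inl_injective hij
      exact mem_setK.1 hα.2 _ _ hl
    · exact absurd h hi
  by_cases hi : i ∈ upperSet α
  · by_cases hj : j ∈ upperSet α
    · exact eq_buddy_of_mem_setJ hα hi hj (mate_ne_inl hij).symm
    · rw [h j i (mate_eq_comm.1 hij) hj, buddy_buddy]
  · exact h i j hij hi

/-! ### The stabiliser of `ζ` -/

/-- Interchanging the rows in `u * ζ = ζ` gives `ζ * star u = ζ`; it remains to multiply by `u`. -/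
theorem zeta_mul_of_mem_stabU {u : Brauer (2 * k)} (hu : u ∈ stabU k) :
    zeta k * u = zeta k := by
  have h := congrArg star hu.2
  rw [star_mul, star_zeta] at h
  conv_lhs => rw [← h, mul_assoc, star_mul_self_of_isUnit hu.1, mul_one]

theorem exists_inv_mem_stabU {u : Brauer (2 * k)} (hu : u ∈ stabU k) :
    ∃ v ∈ stabU k, v * u = 1 := by
  obtain ⟨⟨u, rfl⟩, h⟩ := hu
  exact ⟨_, ⟨u⁻¹.isUnit, by rw [Units.inv_mul_eq_iff_eq_mul, h]⟩, u.inv_mul⟩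

theorem greenLRel_stabU_iff {α β : Brauer (2 * k)} :
    GreenLRel (stabU k) α β ↔ ∃ u ∈ stabU k, u * α = β := by
  constructor
  · intro h
    have : β ∈ (fun u => u * β) '' (stabU k : Set (Brauer (2 * k))) :=
      ⟨1, (stabU k).one_mem, one_mul β⟩
    rwa [← h] at this
  · rintro ⟨u, hu, rfl⟩
    obtain ⟨v, hv, hvu⟩ := exists_inv_mem_stabU hu
    refine Set.Subset.antisymm ?_ ?_
    · rintro _ ⟨w, hw, rfl⟩
      refine ⟨w * v, (stabU k).mul_mem hw hv, ?_⟩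
      simp only [mul_assoc]
      rw [← mul_assoc v, hvu, one_mul]
    · rintro _ ⟨w, hw, rfl⟩
      exact ⟨w * u, (stabU k).mul_mem hw hu, mul_assoc _ _ _⟩

theorem mul_mem_setK_of_mem_stabU {u α : Brauer (2 * k)} (hu : u ∈ stabU k)
    (hα : α ∈ setK k) : u * α ∈ setK k := by
  obtain ⟨s, hs⟩ := hα
  exact ⟨s, by rw [mul_assoc, ← hs, hu.2]⟩

theorem mul_mem_setJ_of_mem_stabU {u α : Brauer (2 * k)} (hu : u ∈ stabU k)
    (hα : α ∈ setJ k) : u * α ∈ setJ k :=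
  ⟨(rank_mul_le_right _ _).trans hα.1, mul_mem_setK_of_mem_stabU hu hα.2⟩

theorem tau_iff {α β : Brauer (2 * k)} : tau k α β ↔ (α ∉ setK k ∧ β ∉ setK k) ∨
    (α ∈ setJ k ∧ β ∈ setJ k ∧ zeta k * α = zeta k * β) ∨
    (α ∈ setK k \ setJ k ∧ β ∈ setK k \ setJ k ∧ ∃ u ∈ stabU k, u * α = β) := by
  change (_ ∨ _ ∨ _) ↔ _
  rw [greenLRel_stabU_iff]
  refine or_congr Iff.rfl (or_congr ?_ Iff.rfl)
  exact and_congr_right fun h => and_congr_right fun h' => chi_iff h h'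

theorem mem_setK_iff_of_tau {α β : Brauer (2 * k)} (h : tau k α β) :
    α ∈ setK k ↔ β ∈ setK k := by
  rcases tau_iff.1 h with ⟨h, h'⟩ | ⟨h, h', -⟩ | ⟨h, h', -⟩
  · exact iff_of_false h h'
  · exact iff_of_true h.2 h'.2
  · exact iff_of_true h.1 h'.1

theorem mem_setJ_iff_of_tau {α β : Brauer (2 * k)} (h : tau k α β) :
    α ∈ setJ k ↔ β ∈ setJ k := by
  rcases tau_iff.1 h with ⟨h, h'⟩ | ⟨h, h', -⟩ | ⟨h, h', -⟩
  · exact iff_of_false (fun hh => h hh.2) (fun hh => h' hh.2)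
  · exact iff_of_true h h'
  · exact iff_of_false h.2 h'.2

/-- The complement of `K` and the set `J` are closed under right multiplication. Left multiplication
by `u ∈ U` preserves `K` and `J` in both directions; and if `α * θ` drops into `J`, then `ζ * u = ζ`
makes `α * θ` and `u * α * θ` equivalent there. -/
theorem isRightCongruence_tau : IsRightCongruence (tau k) := by
  intro α β θ h
  rw [tau_iff] at h ⊢
  rcases h with ⟨h, h'⟩ | ⟨h, h', hz⟩ | ⟨-, -, u, hu, rfl⟩
  · exact .inl ⟨fun hh => h (GreenRLe.of_mul hh), fun hh => h' (GreenRLe.of_mul hh)⟩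
  · exact .inr (.inl ⟨mul_mem_setJ h θ, mul_mem_setJ h' θ,
      by rw [← mul_assoc, ← mul_assoc, hz]⟩)
  · obtain ⟨v, hv, hvu⟩ := exists_inv_mem_stabU hu
    have hback : v * (u * (α * θ)) = α * θ := by rw [← mul_assoc, hvu, one_mul]
    rw [mul_assoc u]
    by_cases hK : α * θ ∈ setK k
    · by_cases hJ : α * θ ∈ setJ k
      · exact .inr (.inl ⟨hJ, mul_mem_setJ_of_mem_stabU hu hJ,
          by rw [← mul_assoc _ u, zeta_mul_of_mem_stabU hu]⟩)
      · exact .inr (.inr ⟨⟨hK, hJ⟩, ⟨mul_mem_setK_of_mem_stabU hu hK, fun h =>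
          hJ (hback ▸ mul_mem_setJ_of_mem_stabU hv h)⟩, u, hu, rfl⟩)
    · exact .inl ⟨hK, fun h => hK (hback ▸ mul_mem_setK_of_mem_stabU hv h)⟩

theorem tauClass_eq_iff {α β : Brauer (2 * k)} : tauClass k α = tauClass k β ↔ tau k α β :=
  Quotient.eq

/-! ### The two actions and the isomorphism of sub-acts -/

theorem GreenRLe.trans {S : Type} [Monoid S] {a b c : S} (h : GreenRLe a b)
    (h' : GreenRLe b c) : GreenRLe a c := by
  obtain ⟨s, rfl⟩ := h
  exact h'.elim fun t ht => ⟨t * s, by rw [ht, mul_assoc]⟩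

/-- The upper blocks of `ζ` cover the whole row, so an element that contains them has no others. -/
theorem greenR_zeta_iff {α : Brauer (2 * k)} : GreenR α (zeta k) ↔ GreenRLe α (zeta k) := by
  refine ⟨fun h => h.1, fun h => ⟨h, greenRLe_iff.2 fun i j hij => ?_⟩⟩
  rw [mate_zeta_inl, ← hij]
  exact (greenRLe_iff.1 h i (buddy i) (mate_zeta_inl i)).symm

/-- Below `γ` only the first two upper vertices are free: they lie on two transversals, or they form
a block, and then the upper row is that of `ζ`. -/
theorem greenR_gamma_or_zeta {α : Brauer (2 * k)} (h : GreenRLe α (gamma k)) :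
    GreenR α (gamma k) ∨ GreenR α (zeta k) := by
  have hα := greenRLe_iff.1 h
  by_cases h' : GreenRLe (gamma k) α
  · exact .inl ⟨h, h'⟩
  right
  rw [greenR_zeta_iff, greenRLe_iff]
  simp only [greenRLe_iff, not_forall] at h'
  obtain ⟨i, j, hij, hne⟩ := h'
  -- An upper block of `α` that is not a block of `γ` lies within the first two vertices.
  have hlt : ∀ i j, mate α (.inl i) = .inl j → mate (gamma k) (.inl i) ≠ .inl j →
      (i : ℕ) < 2 := by
    intro i j hij hne
    by_contra hi
    have h1 := hα i _ (mate_gamma_inl_of_le hi)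
    rw [hij] at h1
    exact hne (h1 ▸ mate_gamma_inl_of_le hi)
  have hi := hlt i j hij hne
  have hj := hlt j i (mate_eq_comm.1 hij) (fun h => hne (mate_eq_comm.1 h))
  have hij' := mate_ne_inl hij
  have hval : (i : ℕ) ≠ j := fun h => hij' (Fin.ext h)
  have hji : j = buddy i := ((half_eq_iff i j).1 (by omega)).resolve_left hij'.symm
  intro a b hab
  rw [mate_zeta_inl] at hab
  obtain rfl := Sum.inl_injective hab
  by_cases ha : (a : ℕ) < 2
  · have : a = i ∨ a = j := by
      rw [Fin.ext_iff, Fin.ext_iff]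
      omega
    rcases this with rfl | rfl
    · rw [hij, hji]
    · rw [mate_eq_comm.1 hij, hji, buddy_buddy]
  · exact hα _ _ (mate_gamma_inl_of_le ha)

theorem zeta_greenRLe_gamma : GreenRLe (zeta k) (gamma k) := by
  refine greenRLe_iff.2 fun i j h => ?_
  by_cases hi : (i : ℕ) < 2
  · rw [mate_gamma_inl hi] at h
    simp at h
  · rw [← h, mate_gamma_inl_of_le hi, mate_zeta_inl]

/-- `Ω₁` is the right ideal generated by `γ`, hence closed under the action. -/
theorem mem_Omega1_iff {α : Brauer (2 * k)} : α ∈ Omega1 k ↔ GreenRLe α (gamma k) := by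
  refine ⟨?_, greenR_gamma_or_zeta⟩
  rintro (h | h)
  · exact h.1
  · exact GreenRLe.trans h.1 zeta_greenRLe_gamma

theorem GreenRLe.mul_right {S : Type} [Monoid S] {a b : S} (h : GreenRLe a b) (s : S) :
    GreenRLe (a * s) b := by
  obtain ⟨t, rfl⟩ := h
  exact ⟨t * s, mul_assoc _ _ _⟩

/-- The action on `R_γ ∪ R_ζ` by right multiplication. -/
def act1 (k : ℕ) : RightAction (Omega1 k) (Brauer (2 * k)) where
  act α β := ⟨α * β, mem_Omega1_iff.2 (GreenRLe.mul_right (mem_Omega1_iff.1 α.2) β)⟩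
  act_act _ _ _ := Subtype.ext (mul_assoc _ _ _)

/-- The action on the classes of the elements of rank at most four. -/
def act2 (k : ℕ) : RightAction (Omega2 k) (Brauer (2 * k)) where
  act c β := ⟨Quotient.map (· * β) (fun _ _ h => isRightCongruence_tau _ _ β h) c.1, by
    obtain ⟨_, α, hα, rfl⟩ := c
    exact ⟨α * β, (rank_mul_le_left α β).trans hα, rfl⟩⟩
  act_act := by
    rintro ⟨_, α, hα, rfl⟩ β θ
    exact Subtype.ext (congrArg (tauClass k) (mul_assoc α β θ))

theorem act2_tauClass {c : Omega2 k} {α : Brauer (2 * k)} (h : (c : Quotient (tau k)) =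
    tauClass k α) (β : Brauer (2 * k)) :
    ((act2 k).act c β : Quotient (tau k)) = tauClass k (α * β) := by
  obtain ⟨c, hc⟩ := c
  obtain rfl : c = _ := h
  rfl

theorem zeta_mul_of_greenR {α : Brauer (2 * k)} (h : GreenR α (zeta k)) : zeta k * α = α := by
  obtain ⟨⟨s, rfl⟩, -⟩ := h
  rw [← mul_assoc, zeta_mul_zeta]

theorem greenR_zeta_mul (α : Brauer (2 * k)) : GreenR (zeta k * α) (zeta k) :=
  greenR_zeta_iff.2 ⟨α, rfl⟩

theorem mem_setJ_of_greenR {α : Brauer (2 * k)} (h : GreenR α (zeta k)) : α ∈ setJ k := by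
  refine ⟨?_, h.2⟩
  obtain ⟨⟨s, rfl⟩, -⟩ := h
  exact (rank_mul_le_left _ _).trans (by rw [rank_zeta]; omega)

/-- Each class in `J` is thus represented in `R_ζ`, which makes `ξ` surjective. -/
theorem tauClass_zeta_mul {α : Brauer (2 * k)} (h : α ∈ setJ k) :
    tauClass k (zeta k * α) = tauClass k α :=
  tauClass_eq_iff.2 (tau_iff.2 (.inr (.inl ⟨mem_setJ_of_greenR (greenR_zeta_mul α), h,
    by rw [← mul_assoc, zeta_mul_zeta]⟩)))

/-- The class of an element of `R_ζ`. -/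
def tauOfRzeta (α : Rzeta k) : Omega3 k :=
  ⟨⟨tauClass k α.1.1, α.1.1, le_trans (mem_setJ_of_greenR α.2).1 (by norm_num : 2 ≤ 4), rfl⟩,
    α.1.1, mem_setJ_of_greenR α.2, rfl⟩

theorem tauOfRzeta_bijective : Function.Bijective (tauOfRzeta (k := k)) := by
  constructor
  · rintro ⟨⟨α, hα⟩, hα'⟩ ⟨⟨β, hβ⟩, hβ'⟩ h
    have h1 : tauClass k α = tauClass k β := congrArg (fun c : Omega3 k => c.1.1) h
    rw [tauClass_eq_iff, tau_iff] at h1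
    have h2 : zeta k * α = zeta k * β := by
      rcases h1 with ⟨h, -⟩ | ⟨-, -, h⟩ | ⟨h, -⟩
      · exact absurd (mem_setJ_of_greenR hα').2 h
      · exact h
      · exact absurd (mem_setJ_of_greenR hα') h.2
    rw [zeta_mul_of_greenR hα', zeta_mul_of_greenR hβ'] at h2
    subst h2
    rfl
  · rintro ⟨⟨c, hc⟩, hc'⟩
    obtain ⟨α, hα, h⟩ := id hc'
    obtain rfl : tauClass k α = c := h
    exact ⟨⟨⟨zeta k * α, .inr (greenR_zeta_mul α)⟩, greenR_zeta_mul α⟩,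
      Subtype.ext (Subtype.ext (tauClass_zeta_mul hα))⟩

/-- The isomorphism of sub-acts that maps each element of `R_ζ` to its class. -/
noncomputable def iso3 (k : ℕ) : RightAction.SubActIso (act1 k) (act2 k) (Rzeta k) (Omega3 k) where
  isSubAct₁ α hα β := greenR_zeta_iff.2 (GreenRLe.mul_right hα.1 β)
  isSubAct₂ := by
    rintro ⟨_, hc⟩ ⟨α, hα, rfl⟩ β
    exact ⟨α * β, mul_mem_setJ hα β, rfl⟩
  toEquiv := Equiv.ofBijective _ tauOfRzeta_bijective
  map_act _ _ := Subtype.ext rfl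

end Brauer

/-! ### Normal forms in a push-out, and the degree bound from a faithful action -/

namespace RightAction

variable {X₁ X₂ S : Type} [Mul S] {μ₁ : RightAction X₁ S} {μ₂ : RightAction X₂ S}
  {Y₁ : Set X₁} {Y₂ : Set X₂}

open Classical in
/-- The normal form of an element of the disjoint union modulo the identified pairs. -/
noncomputable def pushoutNF (ξ : SubActIso μ₁ μ₂ Y₁ Y₂) : X₁ ⊕ X₂ → {x // x ∉ Y₁} ⊕ X₂ :=
  Sum.elim (fun x => if h : x ∈ Y₁ then .inr (ξ.toEquiv ⟨x, h⟩) else .inl ⟨x, h⟩) .inr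

theorem pushoutNF_of_mem (ξ : SubActIso μ₁ μ₂ Y₁ Y₂) {x : X₁} (h : x ∈ Y₁) :
    pushoutNF ξ (.inl x) = .inr (ξ.toEquiv ⟨x, h⟩) := by
  simp [pushoutNF, h]

theorem pushoutNF_of_notMem (ξ : SubActIso μ₁ μ₂ Y₁ Y₂) {x : X₁} (h : x ∉ Y₁) :
    pushoutNF ξ (.inl x) = .inl ⟨x, h⟩ := by
  simp [pushoutNF, h]

/-- The push-out is the second set together with the complement of the first sub-act. -/
noncomputable def pushoutEquiv (ξ : SubActIso μ₁ μ₂ Y₁ Y₂) :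
    Pushout ξ ≃ {x // x ∉ Y₁} ⊕ X₂ where
  toFun := Quot.lift (pushoutNF ξ) (by
    rintro _ _ ⟨y⟩
    exact pushoutNF_of_mem ξ y.2)
  invFun := Sum.elim (fun x => Quot.mk _ (.inl x)) (fun x => Quot.mk _ (.inr x))
  left_inv := by
    rintro ⟨x | x⟩
    · by_cases h : x ∈ Y₁
      · refine (congrArg _ (pushoutNF_of_mem ξ h)).trans ?_
        exact (Quot.sound (PushoutRel.glue ⟨x, h⟩)).symm
      · exact congrArg _ (pushoutNF_of_notMem ξ h)
    · rfl
  right_inv := by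
    rintro (⟨x, h⟩ | x)
    · exact pushoutNF_of_notMem ξ h
    · rfl

/-- Both acts embed in the push-out, so equality of two actions on it can be tested in `Ω₁` and in
`Ω₂` separately. -/
theorem pushout_inr_injective (ξ : SubActIso μ₁ μ₂ Y₁ Y₂) :
    Function.Injective (fun x => (Quot.mk _ (.inr x) : Pushout ξ)) :=
  fun _ _ h => Sum.inr_injective ((pushoutEquiv ξ).symm.injective h)

theorem pushout_inl_injective (ξ : SubActIso μ₁ μ₂ Y₁ Y₂) :
    Function.Injective (fun x => (Quot.mk _ (.inl x) : Pushout ξ)) := by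
  intro x y h
  have h' : pushoutNF ξ (.inl x) = pushoutNF ξ (.inl y) := congrArg (pushoutEquiv ξ) h
  by_cases hx : x ∈ Y₁ <;> by_cases hy : y ∈ Y₁
  · rw [pushoutNF_of_mem ξ hx, pushoutNF_of_mem ξ hy] at h'
    exact congrArg Subtype.val (ξ.toEquiv.injective (Subtype.ext (Sum.inr_injective h')))
  · rw [pushoutNF_of_mem ξ hx, pushoutNF_of_notMem ξ hy] at h'
    cases h'
  · rw [pushoutNF_of_notMem ξ hx, pushoutNF_of_mem ξ hy] at h'
    cases h'
  · rw [pushoutNF_of_notMem ξ hx, pushoutNF_of_notMem ξ hy] at h'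
    exact congrArg Subtype.val (Sum.inl_injective h')

end RightAction

theorem transDegree_le {X S : Type} [Mul S] [Finite X] [Nonempty X] (μ : RightAction X S)
    (h : μ.Faithful) : transDegree S ≤ Nat.card X := by
  refine Nat.sInf_le ⟨Nat.card_pos, ?_⟩
  let e := Finite.equivFin X
  -- The opposite monoid turns composition of functions into composition from left to right.
  refine ⟨⟨fun a => MulOpposite.op fun i => e (μ.act (e.symm i) a), fun a b => ?_⟩, ?_⟩
  · refine MulOpposite.unop_injective (funext fun i => ?_)
    change e (μ.act (e.symm i) (a * b)) = e (μ.act (e.symm (e (μ.act (e.symm i) a))) b)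
    rw [e.symm_apply_apply, μ.act_act]
  · intro a b hab
    refine h a b fun x => e.injective ?_
    have := congrFun (congrArg MulOpposite.unop hab) (e x)
    change e (μ.act (e.symm (e x)) a) = e (μ.act (e.symm (e x)) b) at this
    rwa [e.symm_apply_apply] at this
-- Faithfulness
namespace Brauer

variable {k : ℕ}

theorem mul_eq_of_pushout_act_eq {σ θ : Brauer (2 * k)}
    (h : ∀ x, (RightAction.pushout (iso3 k)).act x σ = (RightAction.pushout (iso3 k)).act x θ)
    {α : Brauer (2 * k)} (hα : GreenRLe α (gamma k)) : α * σ = α * θ := by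
  have := h (Quot.mk _ (.inl ⟨α, mem_Omega1_iff.2 hα⟩))
  exact congrArg Subtype.val (RightAction.pushout_inl_injective (iso3 k) this)

theorem tau_of_pushout_act_eq {σ θ : Brauer (2 * k)}
    (h : ∀ x, (RightAction.pushout (iso3 k)).act x σ = (RightAction.pushout (iso3 k)).act x θ)
    {α : Brauer (2 * k)} (hα : (α : Partn (2 * k)).rank ≤ 4) : tau k (α * σ) (α * θ) := by
  have := h (Quot.mk _ (.inr ⟨tauClass k α, α, hα, rfl⟩))
  exact tauClass_eq_iff.1
    (congrArg Subtype.val (RightAction.pushout_inr_injective (iso3 k) this))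

/-- The elements below `γ` separate the lower rows. -/
theorem exists_gamma_mul (hk : 2 ≤ k) {s t : Fin (2 * k)} (hst : s ≠ t) :
    ∃ α, GreenRLe α (gamma k) ∧ mate α (.inl ⟨0, by omega⟩) = .inr s ∧
      mate α (.inl ⟨1, by omega⟩) = .inr t := by
  obtain ⟨π, h⟩ := Equiv.Perm.exists_extending_pair
    ![(⟨0, by omega⟩ : Fin (2 * k)), ⟨1, by omega⟩] ![s, t]
    (by simp [Function.Injective, Fin.forall_fin_two])
    (by simp [Function.Injective, Fin.forall_fin_two, hst, hst.symm])
  have h0 : π ⟨0, by omega⟩ = s := h 0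
  have h1 : π ⟨1, by omega⟩ = t := h 1
  refine ⟨gamma k * ofPerm π, ⟨_, rfl⟩, ?_, ?_⟩
  · exact mate_mul_through (mate_gamma_inl (by simp)) (by rw [mate_ofPerm_inl, h0])
  · exact mate_mul_through (mate_gamma_inl (by simp)) (by rw [mate_ofPerm_inl, h1])

/-- If `σ` had a transversal `{s, c'}`, an `α` leading the first vertex to `s` would give `α * σ` a
transversal at `c'`, whereas `α * θ` keeps the lower block `{c', t'}`. If `σ` has a lower block at
`c'`, it is visible in `γ * σ = γ * θ`. -/
theorem mate_inr_eq_inr_of_gamma (hk : 2 ≤ k) {σ θ : Brauer (2 * k)}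
    (h : ∀ α, GreenRLe α (gamma k) → α * σ = α * θ) {c t : Fin (2 * k)}
    (hc : mate θ (.inr c) = .inr t) : mate σ (.inr c) = .inr t := by
  rcases mate_inr_cases σ c with ⟨s, hs⟩ | ⟨s, hs⟩
  · have h1 := h (gamma k) ⟨1, (mul_one _).symm⟩
    rw [hs, ← mate_mul_lower (α := gamma k) hs, h1, mate_mul_lower hc]
  -- Here `buddy s` merely serves as some point other than `s`.
  · obtain ⟨α, hα, h0, -⟩ := exists_gamma_mul hk (buddy_ne s).symm
    have h1 := mate_mul_through h0 (mate_eq_comm.1 hs)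
    rw [mate_eq_comm, h α hα, mate_mul_lower hc] at h1
    simp at h1

/-- If `c'` is joined to `s` in `σ` and to `t ≠ s` in `θ`, an `α` leading the first two vertices to
`s` and `t` makes `α * σ` and `α * θ` join `c'` to different upper vertices. -/
theorem mate_inr_eq_of_gamma (hk : 2 ≤ k) {σ θ : Brauer (2 * k)}
    (h : ∀ α, GreenRLe α (gamma k) → α * σ = α * θ) (c : Fin (2 * k)) :
    mate σ (.inr c) = mate θ (.inr c) := by
  rcases mate_inr_cases θ c with ⟨t, ht⟩ | ⟨t, ht⟩
  · rw [ht, mate_inr_eq_inr_of_gamma hk h ht]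
  · rcases mate_inr_cases σ c with ⟨s, hs⟩ | ⟨s, hs⟩
    · rw [hs, mate_inr_eq_inr_of_gamma hk (fun α hα => (h α hα).symm) hs]
    · rw [ht, hs]
      by_contra hst
      obtain ⟨α, hα, h0, h1⟩ := exists_gamma_mul hk (s := s) (t := t) (by simpa using hst)
      have h2 := mate_mul_through h0 (mate_eq_comm.1 hs)
      have h3 := mate_mul_through h1 (mate_eq_comm.1 ht)
      rw [mate_eq_comm, h α hα] at h2
      rw [mate_eq_comm, h2] at h3
      simp at h3

/-- The involution that fixes the first four points and interchanges the other neighbours. -/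
def buddyFrom4 (i : Fin (2 * k)) : Fin (2 * k) := if (i : ℕ) < 4 then i else buddy i

theorem buddy_lt_four {i : Fin (2 * k)} : (buddy i : ℕ) < 4 ↔ (i : ℕ) < 4 := by
  have : (buddy i : ℕ) / 2 = i / 2 := ((half_eq_iff i _).2 (.inr rfl)).symm
  omega

theorem buddyFrom4_involutive : Function.Involutive (buddyFrom4 (k := k)) := by
  intro i
  by_cases h : (i : ℕ) < 4
  · simp [buddyFrom4, h]
  · simp only [buddyFrom4, h, if_false, buddy_lt_four, buddy_buddy]

theorem buddyFrom4_ne {i : Fin (2 * k)} (h : ¬ (i : ℕ) < 4) : buddyFrom4 i ≠ i := by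
  rw [buddyFrom4, if_neg h]
  exact buddy_ne i

theorem rank_proj_buddyFrom4 :
    (proj buddyFrom4 (buddyFrom4_involutive (k := k)) : Partn (2 * k)).rank ≤ 4 := by
  rw [rank_proj]
  have : (Set.Iio 4 : Set ℕ).ncard = 4 := by
    rw [← Finset.coe_Iio, Set.ncard_coe_finset, Nat.card_Iio]
  rw [← this]
  refine Set.ncard_le_ncard_of_injOn Fin.val (fun i hi => ?_) Fin.val_injective.injOn
    (Set.finite_Iio 4)
  by_contra h
  exact buddyFrom4_ne h hi

/-- Since the transversals agree, a difference is a path `a, b, c, d` with `{a,b}` and `{c,d}` in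
`σ` and `{b,c}` in `θ`. An element of rank four tells these apart by membership in `K`, which `τ`
respects. -/
theorem mate_inl_eq_of_tau (hk : 2 ≤ k) {σ θ : Brauer (2 * k)}
    (h : ∀ α : Brauer (2 * k), (α : Partn (2 * k)).rank ≤ 4 → tau k (α * σ) (α * θ))
    (h' : ∀ c, mate σ (.inr c) = mate θ (.inr c)) (b : Fin (2 * k)) :
    mate σ (.inl b) = mate θ (.inl b) := by
  rcases mate_inl_cases σ b with ⟨a, ha⟩ | ⟨e, he⟩
  swap
  · rw [he, eq_comm, mate_eq_comm, ← h', mate_eq_comm, he]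
  rcases mate_inl_cases θ b with ⟨c, hc⟩ | ⟨e, he⟩
  swap
  · rw [he, mate_eq_comm, h', mate_eq_comm, he]
  rcases mate_inl_cases σ c with ⟨d, hd⟩ | ⟨e, he⟩
  swap
  · rw [mate_eq_comm, h', mate_eq_comm, mate_eq_comm.1 hc] at he
    simp at he
  by_contra hac
  have hac' : a ≠ c := by
    rintro rfl
    exact hac (ha.trans hc.symm)
  have hab := (mate_ne_inl ha).symm
  have hbc := mate_ne_inl hc
  have hcd := mate_ne_inl hd
  have had : a ≠ d := by
    rintro rfl
    rw [mate_eq_comm, mate_eq_comm.1 ha] at hd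
    exact hbc (Sum.inl_injective hd)
  have hbd : b ≠ d := by
    rintro rfl
    rw [mate_eq_comm, ha] at hd
    exact hac' (Sum.inl_injective hd)
  obtain ⟨π, hπ⟩ := Equiv.Perm.exists_extending_pair
    (Fin.castLE (by omega : 4 ≤ 2 * k)) ![a, b, c, d] (Fin.castLE_injective _) (by
      intro i j hij
      fin_cases i <;> fin_cases j <;>
        simp [hab, hac', hbc, hcd, had, hbd, hab.symm, hac'.symm, hbc.symm, hcd.symm, had.symm,
          hbd.symm] at hij ⊢)
  have h0 : π ⟨0, by omega⟩ = a := hπ 0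
  have h1 : π ⟨1, by omega⟩ = b := hπ 1
  have h2 : π ⟨2, by omega⟩ = c := hπ 2
  have h3 : π ⟨3, by omega⟩ = d := hπ 3
  -- The first four upper vertices are led to `a, b, c, d`; all others are paired with their
  -- neighbours.
  set α : Brauer (2 * k) := proj buddyFrom4 buddyFrom4_involutive * ofPerm π with hα
  have hlt : ∀ i : Fin (2 * k), (i : ℕ) < 4 → mate α (.inl i) = .inr (π i) := fun i hi =>
    mate_mul_through (mate_proj_inl_self (if_pos hi)) (mate_ofPerm_inl _ _)
  have hge : ∀ i : Fin (2 * k), ¬ (i : ℕ) < 4 → mate α (.inl i) = .inl (buddy i) := by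
    intro i hi
    refine mate_mul_upper ((mate_proj_inl (buddyFrom4_ne hi)).trans ?_)
    rw [buddyFrom4, if_neg hi]
  have hσ : α * σ ∈ setK k := by
    refine greenRLe_iff.2 fun i j hij => ?_
    have hb : mate (zeta k) (.inl i) = .inl (buddy i) := mate_zeta_inl i
    rw [← hij, hb]
    by_cases hi : (i : ℕ) < 4
    · have hi' := hlt _ hi
      have hi'' := hlt _ (buddy_lt_four.2 hi)
      refine (mate_mul_cap hi' ?_ hi'').symm
      obtain ⟨i, hi0⟩ := i
      have : i < 4 := hi
      interval_cases i
      · have : buddy (⟨0, hi0⟩ : Fin (2 * k)) = ⟨1, by omega⟩ := Fin.ext (by simp [buddy])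
        rw [this, h0, h1, mate_eq_comm, ha]
      · have : buddy (⟨1, hi0⟩ : Fin (2 * k)) = ⟨0, by omega⟩ := Fin.ext (by simp [buddy])
        rw [this, h0, h1, ha]
      · have : buddy (⟨2, hi0⟩ : Fin (2 * k)) = ⟨3, by omega⟩ := Fin.ext (by simp [buddy])
        rw [this, h2, h3, hd]
      · have : buddy (⟨3, hi0⟩ : Fin (2 * k)) = ⟨2, by omega⟩ := Fin.ext (by simp [buddy])
        rw [this, h2, h3, mate_eq_comm, hd]
    · exact (mate_mul_upper (hge i hi)).symm
  -- `α * θ` joins the second vertex to the third, and these are not neighbours.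
  have hθ : α * θ ∉ setK k := by
    intro hK
    have := mem_setK.1 hK _ _ (mate_mul_cap (hlt ⟨1, by omega⟩ (by simp)) (h1 ▸ hc)
      (h2 ▸ hlt ⟨2, by omega⟩ (by simp)))
    simp [buddy] at this
  exact hθ ((mem_setK_iff_of_tau
    (h α ((rank_mul_le_left _ _).trans rank_proj_buddyFrom4))).1 hσ)

theorem pushout_faithful (hk : 2 ≤ k) : (RightAction.pushout (iso3 k)).Faithful := by
  intro σ θ h
  have h1 := mate_inr_eq_of_gamma hk fun α hα => mul_eq_of_pushout_act_eq h hα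
  refine ext_mate ?_
  rintro (i | i)
  · exact mate_inl_eq_of_tau hk (fun α hα => tau_of_pushout_act_eq h hα) h1 i
  · exact h1 i

end Brauer

/-! ### Counting involutions and their extensions -/

/-- Two fixed-point-free involutions on finite sets of the same size are conjugate. -/
theorem exists_equiv_conj_involutions {X Y : Type} [Finite X] [Finite Y] {a : X → X} {b : Y → Y}
    (ha : Function.Involutive a) (ha' : ∀ x, a x ≠ x) (hb : Function.Involutive b)
    (hb' : ∀ y, b y ≠ y) (h : Nat.card X = Nat.card Y) :
    ∃ e : X ≃ Y, ∀ x, e (a x) = b (e x) := by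
  classical
  have := Fintype.ofFinite X
  let e := (Finite.equivFinOfCardEq h).trans (Finite.equivFin Y).symm
  let p : Equiv.Perm X := ha.toPerm a
  -- `b` is carried over to `X` along an arbitrary bijection, so that conjugacy in one symmetric
  -- group applies.
  let q : Equiv.Perm X := (e.trans (hb.toPerm b)).trans e.symm
  -- All cycles have length two and there are no fixed points, so the cycle type depends only on the
  -- size of `X`.
  have key : ∀ r : Equiv.Perm X, (∀ x, r (r x) = x) → (∀ x, r x ≠ x) →
      r.cycleType = Multiset.replicate r.cycleType.card 2 ∧
        r.cycleType.card * 2 = Fintype.card X := by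
    intro r hr hr'
    have h1 : r.cycleType = Multiset.replicate r.cycleType.card 2 := by
      refine Multiset.eq_replicate_card.2 (Equiv.Perm.pow_prime_eq_one_iff.1 ?_)
      ext x
      simp [pow_two, hr]
    refine ⟨h1, ?_⟩
    have h2 := r.sum_cycleType
    rw [h1, Multiset.sum_replicate, smul_eq_mul] at h2
    rw [h2, ← Finset.card_univ]
    congr 1
    ext x
    simp [hr']
  have hp := key p ha ha'
  have hq := key q (fun x => by simp [q, hb _]) (fun x hx => hb' (e x) (by
    rw [← e.symm.injective.eq_iff, e.symm_apply_apply]; exact hx))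
  have hcard : p.cycleType.card = q.cycleType.card := by
    have := hp.2.trans hq.2.symm
    omega
  have hpq : IsConj p q := Equiv.Perm.isConj_iff_cycleType_eq.2 (by rw [hp.1, hq.1, hcard])
  obtain ⟨c, hc⟩ := isConj_iff.1 hpq
  refine ⟨c.trans e, fun x => ?_⟩
  have h1 : c (p x) = q (c x) := by
    rw [← hc]
    simp
  change e (c (p x)) = b (e (c x))
  rw [h1]
  exact e.apply_symm_apply _

/-- Used to count classes `f a` by the values of a complete invariant `g`. -/
theorem ncard_image_eq_of_iff {X Y Z : Type} {f : X → Y} {g : X → Z} {A : Set X}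
    (h : ∀ a ∈ A, ∀ b ∈ A, f a = f b ↔ g a = g b) : (f '' A).ncard = (g '' A).ncard := by
  have hs : ∀ y ∈ f '' A, ∃ a ∈ A, f a = y := fun y hy => hy
  choose s hs hs' using hs
  refine Set.ncard_congr (fun y hy => g (s y hy)) (fun y hy => ⟨_, hs y hy, rfl⟩) ?_ ?_
  · intro y y' hy hy' hyy
    rw [← hs' y hy, ← hs' y' hy']
    exact (h _ (hs y hy) _ (hs y' hy')).2 hyy
  · rintro _ ⟨a, ha, rfl⟩
    have hfa : f a ∈ f '' A := ⟨a, ha, rfl⟩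
    exact ⟨f a, hfa, (h _ (hs _ hfa) _ ha).1 (hs' _ hfa)⟩

theorem ncard_fibered {X Z : Type} [Finite X] [Finite Z] (P : X → Prop) (Q : X → Z → Prop)
    (c : ℕ) (h : ∀ x, P x → {z | Q x z}.ncard = c) :
    {p : X × Z | P p.1 ∧ Q p.1 p.2}.ncard = c * Nat.card {x // P x} := by
  have e : {p : X × Z | P p.1 ∧ Q p.1 p.2} ≃ (x : {x // P x}) × {z | Q x.1 z} :=
    { toFun := fun p => ⟨⟨p.1.1, p.2.1⟩, p.1.2, p.2.2⟩
      invFun := fun p => ⟨(p.1.1, p.2.1), p.1.2, p.2.2⟩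
      left_inv := fun _ => rfl
      right_inv := fun _ => rfl }
  have := Fintype.ofFinite {x // P x}
  rw [← Nat.card_coe_set_eq, Nat.card_congr e, Nat.card_sigma]
  have h1 : ∀ x : {x // P x}, Nat.card {z | Q x.1 z} = c := fun x => by
    rw [Nat.card_coe_set_eq, h x.1 x.2]
  simp only [h1, Finset.sum_const, Finset.card_univ, smul_eq_mul, mul_comm,
    Nat.card_eq_fintype_card]

/-- Fixed-point-free involutions. -/
def pairings (X : Type) : Set (X → X) := {g | Function.Involutive g ∧ ∀ x, g x ≠ x}

theorem card_pairings_four : (pairings (Fin 4)).ncard = 3 := by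
  have h : Fintype.card {g : Fin 4 → Fin 4 // (∀ x, g (g x) = x) ∧ ∀ x, g x ≠ x} = 3 := by
    decide +kernel
  rw [← Nat.card_coe_set_eq, ← h, ← Nat.card_eq_fintype_card]
  rfl

/-- The pairings that extend an involution. -/
def extPairings {X : Type} (f : X → X) : Set (X → X) :=
  {g | g ∈ pairings X ∧ ∀ x, f x ≠ x → g x = f x}

/-- On the points moved by `f` the involution `g` agrees with `f` and permutes them, so it also
preserves the fixed points of `f`. -/
theorem apply_eq_of_mem_extPairings {X : Type} {f g : X → X} (hf : Function.Involutive f)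
    (hg : g ∈ extPairings f) {x : X} (hx : f x = x) : f (g x) = g x := by
  by_contra h
  have h1 := hg.2 _ h
  rw [hg.1.1] at h1
  exact h (h1.symm.trans (hx.symm.trans ((congrArg f h1).trans (hf _))))

open Classical in
-- Extending `f` amounts to pairing its four fixed points, which can be done in three ways.
theorem card_extPairings {X : Type} [Finite X] {f : X → X} (hf : Function.Involutive f)
    (h : (Function.fixedPoints f).ncard = 4) : (extPairings f).ncard = 3 := by
  have e : Fin 4 ≃ Function.fixedPoints f :=
    (Finite.equivFinOfCardEq (by rw [Nat.card_coe_set_eq, h])).symm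
  -- `Φ p` acts as `p` on the fixed points of `f`, labelled by `e`, and as `f` elsewhere.
  let Φ : (Fin 4 → Fin 4) → X → X := fun p x =>
    if hx : f x = x then e (p (e.symm ⟨x, hx⟩)) else f x
  have hfix : ∀ i, f (e i) = e i := fun i => (e i).2
  have hΦ : ∀ p i, Φ p (e i) = e (p i) := by
    intro p i
    have h1 : e.symm ⟨e i, hfix i⟩ = i := e.symm_apply_apply i
    exact (dif_pos (hfix i)).trans (by rw [h1])
  have hΦ' : ∀ p x, f x ≠ x → Φ p x = f x := fun p x hx => dif_neg hx
  have hcases : ∀ x, f x = x → ∃ i, (e i : X) = x := fun x hx =>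
    ⟨e.symm ⟨x, hx⟩, by simp⟩
  have hff : ∀ x, f x ≠ x → f (f x) ≠ f x := fun x hx h => hx (hf.injective h)
  rw [← card_pairings_four, ← Set.ncard_image_of_injective (f := Φ)]
  · congr 1
    ext g
    constructor
    · intro hg
      have hg' : ∀ i, f (g (e i)) = g (e i) := fun i =>
        apply_eq_of_mem_extPairings hf hg (hfix i)
      let p : Fin 4 → Fin 4 := fun i => e.symm ⟨g (e i), hg' i⟩
      have hp : ∀ i, (e (p i) : X) = g (e i) := fun i => by simp [p]
      refine ⟨p, ⟨fun i => e.injective (Subtype.ext ?_), fun i hi => ?_⟩, ?_⟩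
      · rw [hp, hp, hg.1.1]
      · exact hg.1.2 (e i) (by rw [← hp, hi])
      · funext x
        by_cases hx : f x = x
        · obtain ⟨i, rfl⟩ := hcases x hx
          rw [hΦ, hp]
        · rw [hΦ' _ _ hx, hg.2 x hx]
    · rintro ⟨p, ⟨hp, hp'⟩, rfl⟩
      refine ⟨⟨fun x => ?_, fun x => ?_⟩, hΦ' p⟩ <;> by_cases hx : f x = x
      · obtain ⟨i, rfl⟩ := hcases x hx
        rw [hΦ, hΦ, hp]
      · rw [hΦ' _ _ hx, hΦ' _ _ (hff x hx), hf]
      · obtain ⟨i, rfl⟩ := hcases x hx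
        rw [hΦ]
        exact fun h => hp' i (e.injective (Subtype.ext h))
      · rwa [hΦ' _ _ hx]
  · intro p q hpq
    funext i
    have := congrFun hpq (e i)
    rw [hΦ, hΦ] at this
    exact e.injective (Subtype.ext this)

/-! ### The orbits of `U` on `K` -/

namespace Brauer

/-- Left multiplication never destroys lower blocks; applied to `u` and to `u⁻¹`, this shows that
none are created either. -/
theorem low_mul_of_isUnit {n : ℕ} {u : Brauer n} (hu : IsUnit u) (α : Brauer n) :
    low (u * α) = low α := by
  have h : ∀ (v β : Brauer n) i, low β i ≠ i → low (v * β) i = low β i := fun v β i hi =>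
    low_eq (mate_mul_lower (mate_eq_of_low_ne hi))
  funext i
  by_cases hi : low α i = i
  · by_contra h'
    rw [hi] at h'
    obtain ⟨u, rfl⟩ := hu
    have := h u⁻¹.val (u.val * α) i h'
    rw [← mul_assoc, Units.inv_mul, one_mul, hi] at this
    exact h' this.symm
  · exact h u α i hi

variable {k : ℕ}

theorem low_zeta_mul_mem {α : Brauer (2 * k)} :
    low (zeta k * α) ∈ extPairings (low α) :=
  ⟨⟨low_involutive _, low_zeta_mul_ne _⟩, fun _ h => low_zeta_mul_of_ne h⟩

/-- The upper blocks of the product are the preimages under `π` of the 2-cycles of `f`. These are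
2-cycles of `g`, which `π` pulls back to pairs of neighbours. -/
theorem mem_setK_ofPerm_mul_proj {f g : Fin (2 * k) → Fin (2 * k)} (hf : Function.Involutive f)
    (hg : g ∈ extPairings f) {π : Equiv.Perm (Fin (2 * k))} (hπ : ∀ i, π (buddy i) = g (π i)) :
    ofPerm π * proj f hf ∈ setK k := by
  refine mem_setK.2 fun i j hij => ?_
  by_cases h : f (π i) = π i
  · rw [mate_mul_through (mate_ofPerm_inl π i) (mate_proj_inl_self h)] at hij
    simp at hij
  · have h1 : mate (ofPerm π) (.inl (buddy i)) = .inr (f (π i)) := by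
      rw [mate_ofPerm_inl, hπ, hg.2 _ h]
    rw [mate_mul_cap (mate_ofPerm_inl π i) (mate_proj_inl h) h1] at hij
    exact (Sum.inl_injective hij).symm

/-- Every pattern occurs in `K`. -/
theorem exists_mem_setK {f g : Fin (2 * k) → Fin (2 * k)} (hf : Function.Involutive f)
    (hg : g ∈ extPairings f) : ∃ α ∈ setK k, low α = f ∧ low (zeta k * α) = g := by
  obtain ⟨π, hπ⟩ := exists_equiv_conj_involutions (X := Fin (2 * k)) buddy_buddy buddy_ne
    hg.1.1 hg.1.2 rfl
  have hlow : low (ofPerm π * proj f hf) = f := by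
    rw [low_mul_of_isUnit (isUnit_ofPerm π), low_proj]
  refine ⟨ofPerm π * proj f hf, mem_setK_ofPerm_mul_proj hf hg hπ, hlow, ?_⟩
  funext j
  by_cases hj : f j = j
  · have h1 : mate (ofPerm π * proj f hf) (.inl (π.symm j)) = .inr j :=
      mate_mul_through ((mate_ofPerm_inl π _).trans (by simp)) (mate_proj_inl_self hj)
    have h2 : mate (ofPerm π * proj f hf) (.inl (buddy (π.symm j))) = .inr (g j) :=
      mate_mul_through ((mate_ofPerm_inl π _).trans (by simp [hπ]))
        (mate_proj_inl_self (apply_eq_of_mem_extPairings hf hg hj))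
    exact low_zeta_mul_eq h1 h2
  · rw [low_zeta_mul_of_ne (by rwa [hlow]), hlow, hg.2 j hj]

/-- On the upper ends of transversals `π` follows the transversals. Off them `buddy` and `low α` are
fixed-point-free involutions on sets of equal size, and any bijection conjugating one to the other
will do. -/
theorem exists_eq_ofPerm_mul_proj {α : Brauer (2 * k)} (hα : α ∈ setK k) :
    ∃ π : Equiv.Perm (Fin (2 * k)), (∀ i, π (buddy i) = low (zeta k * α) (π i)) ∧
      ofPerm π * proj (low α) (low_involutive α) = α := by
  classical
  have hcard : Nat.card {i // i ∈ upperSet α} = Nat.card {i // i ∈ lowerSet α} := by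
    change Nat.card (upperSet α) = Nat.card (lowerSet α)
    rw [Nat.card_coe_set_eq, Nat.card_coe_set_eq, ← rank_eq_upperSet, ← rank_eq_lowerSet]
  have hcard' : Nat.card {i // i ∉ upperSet α} = Nat.card {i // i ∉ lowerSet α} := by
    change Nat.card ((upperSet α)ᶜ : Set _) = Nat.card ((lowerSet α)ᶜ : Set _)
    rw [Nat.card_coe_set_eq, Nat.card_coe_set_eq, Set.ncard_compl, Set.ncard_compl,
      ← rank_eq_upperSet, ← rank_eq_lowerSet]
  have hU : ∀ i ∉ upperSet α, mate α (.inl i) = .inl (buddy i) := by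
    intro i hi
    rcases mate_inl_cases α i with ⟨j, hj⟩ | h
    · rw [hj, mem_setK.1 hα _ _ hj]
    · exact absurd h hi
  have hbU : ∀ i ∉ upperSet α, buddy i ∉ upperSet α := by
    rintro i hi ⟨j, hj⟩
    rw [mate_eq_comm.1 (hU i hi)] at hj
    simp at hj
  have hL : ∀ i ∉ lowerSet α, low α i ∉ lowerSet α := by
    intro i hi h
    rw [← low_eq_self_iff] at h hi
    exact hi ((low_involutive α).injective h)
  choose t ht using fun i : {i // i ∈ upperSet α} => i.2
  have ht' : Function.Bijective (fun i => (⟨t i, _, mate_eq_comm.1 (ht i)⟩ :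
      {i // i ∈ lowerSet α})) := by
    refine (Nat.bijective_iff_injective_and_card _).2 ⟨fun i j hij => ?_, hcard⟩
    have h1 : t i = t j := congrArg Subtype.val hij
    have h2 := mate_eq_comm.1 (ht i)
    rw [h1, mate_eq_comm.1 (ht j)] at h2
    exact Subtype.ext (Sum.inl_injective h2).symm
  obtain ⟨e, he⟩ := exists_equiv_conj_involutions (X := {i // i ∉ upperSet α})
    (Y := {i // i ∉ lowerSet α}) (a := fun i => ⟨buddy i, hbU i i.2⟩)
    (b := fun i => ⟨low α i, hL i i.2⟩) (fun i => Subtype.ext (buddy_buddy _))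
    (fun i h => buddy_ne _ (congrArg Subtype.val h))
    (fun i => Subtype.ext (low_involutive α _))
    (fun i h => i.2 (low_eq_self_iff.1 (congrArg Subtype.val h))) hcard'
  let π := Equiv.subtypeCongr (Equiv.ofBijective _ ht') e
  have hπ : ∀ i (hi : i ∈ upperSet α), mate α (.inl i) = .inr (π i) := by
    intro i hi
    have : π i = t ⟨i, hi⟩ := by simp [π, Equiv.subtypeCongr, hi]
    rw [this]
    exact ht ⟨i, hi⟩
  have hπ' : ∀ i (hi : i ∉ upperSet α), π i = e ⟨i, hi⟩ := by
    intro i hi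
    simp [π, Equiv.subtypeCongr, hi]
  have hπL : ∀ i, i ∉ upperSet α → low α (π i) ≠ π i := by
    intro i hi
    rw [hπ' i hi]
    exact fun h => (e ⟨i, hi⟩).2 (low_eq_self_iff.1 h)
  have hπb : ∀ i, i ∉ upperSet α → π (buddy i) = low α (π i) := by
    intro i hi
    rw [hπ' _ (hbU i hi), hπ' i hi]
    exact congrArg Subtype.val (he ⟨i, hi⟩)
  refine ⟨π, fun i => ?_, ?_⟩
  · by_cases hi : i ∈ upperSet α
    · exact (low_zeta_mul_eq (hπ i hi) (hπ _ (exists_mate_buddy hα (hπ i hi)))).symm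
    · rw [hπb i hi, low_zeta_mul_of_ne (hπL i hi)]
  · have hup : ∀ i, mate (ofPerm π * proj (low α) (low_involutive α)) (.inl i) =
        mate α (.inl i) := by
      intro i
      by_cases hi : i ∈ upperSet α
      · rw [hπ i hi]
        exact mate_mul_through (mate_ofPerm_inl π i)
          (mate_proj_inl_self (low_eq_self_iff.2 ⟨_, mate_eq_comm.1 (hπ i hi)⟩))
      · rw [hU i hi]
        exact mate_mul_cap (mate_ofPerm_inl π i) (mate_proj_inl (hπL i hi))
          ((mate_ofPerm_inl π _).trans (by rw [hπb i hi]))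
    refine ext_mate ?_
    rintro (i | i)
    · exact hup i
    · rcases mate_inr_cases α i with ⟨j, hj⟩ | ⟨j, hj⟩
      · have h1 := low_eq hj
        have h2 : low α i ≠ i := by rw [h1]; exact (mate_ne_inr hj).symm
        rw [hj, mate_mul_lower (mate_proj_inr h2), h1]
      · rw [hj, mate_eq_comm, hup, mate_eq_comm, hj]

/-- The orbits of the stabiliser of `ζ` on `K`. -/
theorem exists_mem_stabU_iff {α β : Brauer (2 * k)} (hα : α ∈ setK k) (hβ : β ∈ setK k) :
    (∃ u ∈ stabU k, u * α = β) ↔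
      (low α, low (zeta k * α)) = (low β, low (zeta k * β)) := by
  constructor
  · rintro ⟨u, hu, rfl⟩
    rw [low_mul_of_isUnit hu.1, ← mul_assoc, zeta_mul_of_mem_stabU hu]
  · intro h
    obtain ⟨h1, h2⟩ := Prod.mk.inj h
    obtain ⟨π, hπ, hπ'⟩ := exists_eq_ofPerm_mul_proj hα
    obtain ⟨ρ, hρ, hρ'⟩ := exists_eq_ofPerm_mul_proj hβ
    -- `π` and `ρ` both conjugate `buddy` to the same pairing, so `π⁻¹ * ρ` commutes with `buddy`,
    -- which means that it fixes `ζ`.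
    have hc : ∀ i, (π⁻¹ * ρ) (buddy i) = buddy ((π⁻¹ * ρ) i) := by
      intro i
      rw [Equiv.Perm.mul_apply, Equiv.Perm.inv_eq_iff_eq, hπ, hρ, h2]
      simp
    have hz : ofPerm (π⁻¹ * ρ) * zeta k = zeta k := by
      refine ext_mate ?_
      rintro (i | i)
      · rw [mate_zeta_inl]
        exact mate_mul_cap (mate_ofPerm_inl _ i) (mate_zeta_inl _)
          ((mate_ofPerm_inl _ _).trans (by rw [hc]))
      · rw [mate_zeta_inr, mate_mul_lower (mate_zeta_inr i)]
    refine ⟨ofPerm (π⁻¹ * ρ), ⟨isUnit_ofPerm _, hz⟩, ?_⟩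
    conv_lhs => rw [← hπ']
    rw [← mul_assoc, ofPerm_mul, mul_inv_cancel_left, ← hρ']
    simp only [h1]

end Brauer
-- The size of `Ω₂`
namespace Brauer

variable {k : ℕ}

theorem rank_eq_fixedPoints_low {n : ℕ} (α : Brauer n) :
    (α : Partn n).rank = (Function.fixedPoints (low α)).ncard := by
  rw [rank_eq_lowerSet, fixedPoints_low]

/-- The row has even length and `low α` moves its points in pairs. This excludes rank three. -/
theorem even_rank (α : Brauer (2 * k)) : Even (α : Partn (2 * k)).rank := by
  classical
  let p : Equiv.Perm (Fin (2 * k)) := (low_involutive α).toPerm _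
  have h1 : 2 ∣ p.support.card := Equiv.Perm.two_dvd_card_support (by
    ext i
    simp [pow_two, p, low_involutive α _])
  have h2 : (Function.fixedPoints (low α)).ncard = (p.supportᶜ).card := by
    rw [← Set.ncard_coe_finset]
    congr 1
    ext i
    simp [p, Function.mem_fixedPoints, Function.IsFixedPt]
  have h3 := p.support.card_add_card_compl
  rw [Fintype.card_fin] at h3
  rw [rank_eq_fixedPoints_low, h2, Nat.even_iff]
  omega

theorem ncard_pairings (n : ℕ) : (pairings (Fin n)).ncard = numProj n 0 := by
  rw [numProj_eq, ← Nat.card_coe_set_eq]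
  refine Nat.card_congr (Equiv.subtypeEquivRight fun f => and_congr_right fun _ => ?_)
  rw [Set.ncard_eq_zero, Set.eq_empty_iff_forall_notMem]
  rfl

/-- The class of `α ∈ J` is determined by the pairing `low (ζ * α)`, and every pairing arises,
already from an element of rank zero. -/
theorem ncard_tauClass_setJ : (tauClass k '' setJ k).ncard = numProj (2 * k) 0 := by
  rw [ncard_image_eq_of_iff (g := fun α => low (zeta k * α)), ← ncard_pairings]
  · congr 1
    ext g
    constructor
    · rintro ⟨α, -, rfl⟩
      exact low_zeta_mul_mem.1
    · intro hg
      obtain ⟨α, hα, h1, h2⟩ := exists_mem_setK hg.1 ⟨hg, fun _ _ => rfl⟩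
      refine ⟨α, ⟨?_, hα⟩, h2⟩
      have h3 : Function.fixedPoints g = ∅ := Set.eq_empty_iff_forall_notMem.2 hg.2
      change _ ≤ 2
      rw [rank_eq_fixedPoints_low, h1, h3, Set.ncard_empty]
      norm_num
  · intro α hα β hβ
    rw [tauClass_eq_iff, tau_iff, ← zeta_mul_eq_zeta_mul_iff]
    constructor
    · rintro (⟨h, -⟩ | ⟨-, -, h⟩ | ⟨h, -⟩)
      · exact absurd hα.2 h
      · exact h
      · exact absurd hα h.2
    · exact fun h => .inr (.inl ⟨hα, hβ, h⟩)

/-- The elements of rank four in `K`. -/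
def rankFourK (k : ℕ) : Set (Brauer (2 * k)) := {α | α ∈ setK k ∧ (α : Partn (2 * k)).rank = 4}

theorem notMem_setJ_of_mem_rankFourK {α : Brauer (2 * k)} (h : α ∈ rankFourK k) :
    α ∉ setJ k := by
  intro hJ
  have h1 : (α : Partn (2 * k)).rank ≤ 2 := hJ.1
  rw [h.2] at h1
  omega

/-- The classes correspond to the pairs of an involution with four fixed points and one of its three
extensions to a pairing. -/
theorem ncard_tauClass_rankFourK :
    (tauClass k '' rankFourK k).ncard = 3 * numProj (2 * k) 4 := by
  rw [ncard_image_eq_of_iff (g := fun α => (low α, low (zeta k * α))), numProj_eq]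
  · refine Eq.trans ?_ (ncard_fibered
      (fun f : Fin (2 * k) → Fin (2 * k) =>
        Function.Involutive f ∧ (Function.fixedPoints f).ncard = 4)
      (fun f g => g ∈ extPairings f) 3 fun f hf => card_extPairings hf.1 hf.2)
    congr 1
    ext ⟨f, g⟩
    constructor
    · rintro ⟨α, ⟨-, hr⟩, h⟩
      obtain ⟨rfl, rfl⟩ := Prod.mk.inj h
      exact ⟨⟨low_involutive α, by rw [← rank_eq_fixedPoints_low, hr]⟩, low_zeta_mul_mem⟩
    · rintro ⟨⟨hf, hr⟩, hg⟩
      obtain ⟨α, hα, rfl, rfl⟩ := exists_mem_setK hf hg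
      exact ⟨α, ⟨hα, by rw [rank_eq_fixedPoints_low, hr]⟩, rfl⟩
  · intro α hα β hβ
    have hαJ := notMem_setJ_of_mem_rankFourK hα
    rw [tauClass_eq_iff, tau_iff, ← exists_mem_stabU_iff hα.1 hβ.1]
    constructor
    · rintro (⟨h, -⟩ | ⟨h, -⟩ | ⟨-, -, h⟩)
      · exact absurd hα.1 h
      · exact absurd h hαJ
      · exact h
    · exact fun h => .inr (.inr ⟨⟨hα.1, hαJ⟩, ⟨hβ.1, notMem_setJ_of_mem_rankFourK hβ⟩, h⟩)

theorem exists_notMem_setK (hk : 2 ≤ k) :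
    ∃ ν : Brauer (2 * k), (ν : Partn (2 * k)).rank ≤ 4 ∧ ν ∉ setK k := by
  let i : Fin (2 * k) := ⟨0, by omega⟩
  let j : Fin (2 * k) := ⟨1, by omega⟩
  let l : Fin (2 * k) := ⟨2, by omega⟩
  have hij : buddy i = j := Fin.ext (by simp [buddy, i, j])
  have hil : i ≠ l := by simp [i, l]
  -- Counting from `0`, interchanging `1` and `2` turns the upper block `{0,1}` of `ζ` into `{0,2}`;
  -- this needs a third vertex.
  refine ⟨ofPerm (Equiv.swap j l) * zeta k, (rank_mul_le_right _ _).trans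
    (by rw [rank_zeta]; omega), fun h => ?_⟩
  have h1 := mem_setK.1 h i l (mate_mul_cap (mate_ofPerm_inl _ i) (mate_zeta_inl _) ?_)
  · rw [hij] at h1
    simp [l, j] at h1
  · rw [mate_ofPerm_inl, Equiv.swap_apply_right,
      Equiv.swap_apply_of_ne_of_ne (by simp [i, j]) hil, hij]

theorem card_Omega2 (hk : 2 ≤ k) :
    Nat.card (Omega2 k) = 1 + 3 * numProj (2 * k) 4 + numProj (2 * k) 0 := by
  obtain ⟨ν, hν, hνK⟩ := exists_notMem_setK hk
  have hdecomp : Omega2 k =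
      ({tauClass k ν} ∪ tauClass k '' rankFourK k) ∪ tauClass k '' setJ k := by
    ext c
    constructor
    · rintro ⟨α, hα, rfl⟩
      by_cases hK : α ∈ setK k
      · by_cases hJ : α ∈ setJ k
        · exact .inr ⟨α, hJ, rfl⟩
        · refine .inl (.inr ⟨α, ⟨hK, ?_⟩, rfl⟩)
          have h1 : ¬ (α : Partn (2 * k)).rank ≤ 2 := fun h => hJ ⟨h, hK⟩
          have h2 : (α : Partn (2 * k)).rank ≤ 4 := hα
          obtain ⟨r, hr⟩ := even_rank α
          omega
      · exact .inl (.inl (tauClass_eq_iff.2 (tau_iff.2 (.inl ⟨hK, hνK⟩))))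
    · rintro ((rfl | ⟨α, hα, rfl⟩) | ⟨α, hα, rfl⟩)
      · exact ⟨ν, hν, rfl⟩
      · exact ⟨α, hα.2.le, rfl⟩
      · exact ⟨α, le_trans hα.1 (by norm_num : 2 ≤ 4), rfl⟩
  have hfin : Finite (Quotient (tau k)) := Quotient.finite _
  rw [Nat.card_coe_set_eq, hdecomp, Set.ncard_union_eq, Set.ncard_union_eq, Set.ncard_singleton,
    ncard_tauClass_rankFourK, ncard_tauClass_setJ]
  -- The three parts are disjoint because `K` and `J` are unions of `τ`-classes.
  · rw [Set.disjoint_singleton_left]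
    rintro ⟨α, hα, h⟩
    exact hνK ((mem_setK_iff_of_tau (tauClass_eq_iff.1 h)).1 hα.1)
  · rw [Set.disjoint_right]
    rintro _ ⟨α, hα, rfl⟩ (h | ⟨β, hβ, h⟩)
    · exact hνK ((mem_setK_iff_of_tau (tauClass_eq_iff.1 h)).1 hα.2)
    · exact notMem_setJ_of_mem_rankFourK hβ
        ((mem_setJ_iff_of_tau (tauClass_eq_iff.1 h)).2 hα)

/-! ### The elements that are `R`-related to `γ` -/

theorem greenR_gamma_iff {α : Brauer (2 * k)} : GreenR α (gamma k) ↔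
    ∀ i : Fin (2 * k), if (i : ℕ) < 2 then i ∈ upperSet α else mate α (.inl i) = .inl (buddy i) := by
  constructor
  · rintro ⟨h1, h2⟩ i
    rw [greenRLe_iff] at h1 h2
    split_ifs with hi
    · rcases mate_inl_cases α i with ⟨j, hj⟩ | h
      · have := h2 i j hj
        rw [mate_gamma_inl hi] at this
        simp at this
      · exact h
    · exact h1 _ _ (mate_gamma_inl_of_le hi)
  · intro h
    refine ⟨greenRLe_iff.2 fun i j hij => ?_, greenRLe_iff.2 fun i j hij => ?_⟩ <;>
      by_cases hi : (i : ℕ) < 2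
    · rw [mate_gamma_inl hi] at hij
      simp at hij
    · have := h i
      rw [if_neg hi] at this
      rw [this, ← hij, mate_gamma_inl_of_le hi]
    · have := h i
      rw [if_pos hi] at this
      obtain ⟨l, hl⟩ := this
      rw [hl] at hij
      simp at hij
    · have := h i
      rw [if_neg hi] at this
      rw [mate_gamma_inl_of_le hi, ← hij, this]

theorem rank_of_greenR_gamma (hk : 2 ≤ k) {α : Brauer (2 * k)} (h : GreenR α (gamma k)) :
    (α : Partn (2 * k)).rank = 2 := by
  rw [greenR_gamma_iff] at h
  have h1 : upperSet α = {⟨0, by omega⟩, ⟨1, by omega⟩} := by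
    ext i
    have hi := h i
    split_ifs at hi with hlt
    · refine iff_of_true hi ?_
      rw [Set.mem_insert_iff, Set.mem_singleton_iff, Fin.ext_iff, Fin.ext_iff]
      change (i : ℕ) = 0 ∨ (i : ℕ) = 1
      omega
    · refine iff_of_false ?_ ?_
      · rintro ⟨j, hj⟩
        rw [hi] at hj
        simp at hj
      · rintro (rfl | rfl) <;> simp at hlt
  rw [rank_eq_upperSet, h1, Set.ncard_pair (by simp)]

/-- The element that is `R`-related to `γ` with given lower blocks and given transversals. -/
theorem exists_greenR_gamma (hk : 2 ≤ k) {f : Fin (2 * k) → Fin (2 * k)}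
    (hf : Function.Involutive f) (hf' : (Function.fixedPoints f).ncard = 2) {x y : Fin (2 * k)}
    (hxy : x ≠ y) (hx : f x = x) (hy : f y = y) :
    ∃ α, GreenR α (gamma k) ∧ low α = f ∧ mate α (.inl ⟨0, by omega⟩) = .inr x ∧
      mate α (.inl ⟨1, by omega⟩) = .inr y := by
  have hfix : ∀ j, j ≠ x → j ≠ y → f j ≠ j := by
    intro j hjx hjy hj
    have h1 : ({x, y} : Set _) = Function.fixedPoints f := Set.eq_of_subset_of_ncard_le
      (by rintro l (rfl | rfl) <;> assumption) (by rw [hf', Set.ncard_pair hxy])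
    have h2 : j ∈ Function.fixedPoints f := hj
    rw [← h1] at h2
    exact h2.elim hjx hjy
  have hfx : ∀ j, f j = x ↔ j = x := fun j => by
    rw [← hf.injective.eq_iff, hf, hx]
  have hfy : ∀ j, f j = y ↔ j = y := fun j => by
    rw [← hf.injective.eq_iff, hf, hy]
  let o : Fin (2 * k) := ⟨0, by omega⟩
  let e : Fin (2 * k) := ⟨1, by omega⟩
  have hoe : e ≠ o := by simp [o, e]
  have ho : buddy o = e := Fin.ext (by simp [buddy, o, e])
  have he : buddy e = o := by rw [← ho, buddy_buddy]
  have hbo : ∀ i, buddy i = o ↔ i = e := fun i => by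
    rw [← he, Function.Involutive.injective buddy_buddy |>.eq_iff]
  have hbe : ∀ i, buddy i = e ↔ i = o := fun i => by
    rw [← ho, Function.Involutive.injective buddy_buddy |>.eq_iff]
  -- Upper blocks as in `γ`, lower blocks from `f`, and the transversals `{o, x'}` and `{e, y'}`.
  let a : Fin (2 * k) ⊕ Fin (2 * k) → Fin (2 * k) ⊕ Fin (2 * k) := Sum.elim
    (fun i => if i = o then .inr x else if i = e then .inr y else .inl (buddy i))
    (fun j => if j = x then .inl o else if j = y then .inl e else .inr (f j))
  have ha : ∀ z, a z ≠ z := by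
    rintro (i | j)
    · by_cases h1 : i = o
      · simp [a, h1]
      · by_cases h2 : i = e
        · simp [a, h2, hoe]
        · simp [a, h1, h2, buddy_ne]
    · by_cases h1 : j = x
      · simp [a, h1]
      · by_cases h2 : j = y
        · simp [a, h2, hxy.symm]
        · simp [a, h1, h2, hfix j h1 h2]
  have ha' : ∀ z, a (a z) = z := by
    rintro (i | j)
    · by_cases h1 : i = o
      · simp [a, h1]
      · by_cases h2 : i = e
        · simp [a, h2, hoe, hxy.symm]
        · simp [a, h1, h2, hbo, hbe, buddy_buddy]
    · by_cases h1 : j = x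
      · simp [a, h1]
      · by_cases h2 : j = y
        · simp [a, h2, hoe, hxy.symm]
        · simp [a, h1, h2, hfx, hfy, hf j]
  have h0 : mate (ofMate a ha ha') (.inl o) = .inr x := by simp [a]
  have h1 : mate (ofMate a ha ha') (.inl e) = .inr y := by simp [a, hoe]
  refine ⟨ofMate a ha ha', greenR_gamma_iff.2 fun i => ?_, ?_, h0, h1⟩
  · split_ifs with hi
    · have : i = o ∨ i = e := by
        rw [Fin.ext_iff, Fin.ext_iff]
        change (i : ℕ) = 0 ∨ (i : ℕ) = 1
        omega
      rcases this with rfl | rfl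
      · exact ⟨x, h0⟩
      · exact ⟨y, h1⟩
    · have h2 : i ≠ o := by rintro rfl; simp [o] at hi
      have h3 : i ≠ e := by rintro rfl; simp [e] at hi
      simp [a, h2, h3]
  · funext j
    by_cases h2 : j = x
    · rw [h2, hx, low_eq_self_iff]
      exact ⟨o, mate_eq_comm.1 h0⟩
    · by_cases h3 : j = y
      · rw [h3, hy, low_eq_self_iff]
        exact ⟨e, mate_eq_comm.1 h1⟩
      · exact low_eq (by simp [a, h2, h3])

/-- The upper blocks are those of `γ`, so only the lower blocks and the ends of the two transversals
can vary. -/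
theorem ext_of_greenR_gamma (hk : 2 ≤ k) {α β : Brauer (2 * k)} (hα : GreenR α (gamma k))
    (hβ : GreenR β (gamma k)) (hlow : low α = low β)
    (h0 : mate α (.inl ⟨0, by omega⟩) = mate β (.inl ⟨0, by omega⟩))
    (h1 : mate α (.inl ⟨1, by omega⟩) = mate β (.inl ⟨1, by omega⟩)) : α = β := by
  rw [greenR_gamma_iff] at hα hβ
  have hup : ∀ i, mate α (.inl i) = mate β (.inl i) := by
    intro i
    have hαi := hα i
    have hβi := hβ i
    split_ifs at hαi hβi with hi
    · obtain ⟨i, hi'⟩ := i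
      have : i < 2 := hi
      interval_cases i
      · exact h0
      · exact h1
    · rw [hαi, hβi]
  refine ext_mate ?_
  rintro (i | i)
  · exact hup i
  · rcases mate_inr_cases α i with ⟨j, hj⟩ | ⟨j, hj⟩
    · have h2 : low α i ≠ i := by rw [low_eq hj]; exact (mate_ne_inr hj).symm
      rw [mate_eq_of_low_ne h2, mate_eq_of_low_ne (hlow ▸ h2), hlow]
    · rw [hj, eq_comm, mate_eq_comm, ← hup, mate_eq_comm, hj]

/-- An element of `R_γ` amounts to a lower pattern with two fixed points and a choice of which of
them is joined to the first upper vertex; hence the factor two. -/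
theorem ncard_greenR_gamma (hk : 2 ≤ k) :
    {α | GreenR α (gamma k)}.ncard = 2 * numProj (2 * k) 2 := by
  let v : Brauer (2 * k) → Fin (2 * k) → Fin (2 * k) := fun α i =>
    Sum.elim id id (mate α (.inl i))
  let o : Fin (2 * k) := ⟨0, by omega⟩
  let e : Fin (2 * k) := ⟨1, by omega⟩
  have hv : ∀ α, GreenR α (gamma k) → ∀ i : Fin (2 * k), (i : ℕ) < 2 →
      mate α (.inl i) = .inr (v α i) := by
    intro α hα i hi
    have := greenR_gamma_iff.1 hα i
    rw [if_pos hi] at this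
    obtain ⟨j, hj⟩ := this
    simp [v, hj]
  have ho : (o : ℕ) < 2 := by simp [o]
  have he : (e : ℕ) < 2 := by simp [e]
  have hcount : ∀ f : Fin (2 * k) → Fin (2 * k), Function.Involutive f ∧
      (Function.fixedPoints f).ncard = 2 → {p : Fin (2 * k) × Fin (2 * k) |
        p.1 ≠ p.2 ∧ f p.1 = p.1 ∧ f p.2 = p.2}.ncard = 2 := by
    rintro f ⟨-, hf⟩
    obtain ⟨x, y, hxy, hs⟩ := Set.ncard_eq_two.1 hf
    have hs' : ∀ z, f z = z ↔ z = x ∨ z = y := fun z => Set.ext_iff.1 hs z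
    rw [Set.ncard_eq_two]
    refine ⟨(x, y), (y, x), by simp [hxy], ?_⟩
    ext ⟨a, b⟩
    simp only [Set.mem_ofPred_eq, hs', Set.mem_insert_iff, Set.mem_singleton_iff, Prod.mk.injEq]
    constructor
    · rintro ⟨h, rfl | rfl, rfl | rfl⟩ <;> simp_all
    · rintro (⟨rfl, rfl⟩ | ⟨rfl, rfl⟩) <;> simp [hxy, hxy.symm]
  rw [← Set.image_id {α | GreenR α (gamma k)},
    ncard_image_eq_of_iff (g := fun α => (low α, (v α o, v α e))), numProj_eq]
  · refine Eq.trans ?_ (ncard_fibered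
      (fun f : Fin (2 * k) → Fin (2 * k) =>
        Function.Involutive f ∧ (Function.fixedPoints f).ncard = 2)
      (fun f (p : Fin (2 * k) × Fin (2 * k)) => p.1 ≠ p.2 ∧ f p.1 = p.1 ∧ f p.2 = p.2) 2 hcount)
    congr 1
    ext ⟨f, x, y⟩
    constructor
    · rintro ⟨α, hα, h⟩
      simp only [Prod.mk.injEq] at h
      obtain ⟨rfl, rfl, rfl⟩ := h
      refine ⟨⟨low_involutive α, ?_⟩, fun h => ?_, low_eq_self_iff.2 ⟨o, ?_⟩,
        low_eq_self_iff.2 ⟨e, ?_⟩⟩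
      · rw [← rank_eq_fixedPoints_low, rank_of_greenR_gamma hk hα]
      · have h1 := hv α hα o ho
        change v α o = v α e at h
        rw [h, ← hv α hα e he] at h1
        have h2 := congrArg (mate α) h1
        simp [o, e] at h2
      · exact mate_eq_comm.1 (hv α hα o ho)
      · exact mate_eq_comm.1 (hv α hα e he)
    · rintro ⟨⟨hf, hr⟩, hxy, hx, hy⟩
      obtain ⟨α, hα, rfl, h0, h1⟩ := exists_greenR_gamma hk hf hr hxy hx hy
      exact ⟨α, hα, by simp [v, o, e, h0, h1]⟩
  · intro α hα β hβ
    refine ⟨fun h => congrArg (fun α => (low α, (v α o, v α e))) h, fun h => ?_⟩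
    simp only [Prod.mk.injEq] at h
    exact ext_of_greenR_gamma hk hα hβ h.1
      ((hv α hα o ho).trans ((congrArg _ h.2.1).trans (hv β hβ o ho).symm))
      ((hv α hα e he).trans ((congrArg _ h.2.2).trans (hv β hβ e he).symm))

theorem card_compl_Rzeta (hk : 2 ≤ k) :
    Nat.card {α // α ∉ Rzeta k} = 2 * numProj (2 * k) 2 := by
  rw [← ncard_greenR_gamma hk, ← Nat.card_coe_set_eq]
  refine Nat.card_congr ⟨fun α => ⟨α.1.1, α.1.2.resolve_right α.2⟩,
    fun α => ⟨⟨α.1, .inl α.2⟩, fun h => ?_⟩, fun _ => rfl, fun _ => rfl⟩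
  -- `R_γ` and `R_ζ` are disjoint, since the ranks are two and zero.
  have h1 := (rank_of_greenR_gamma hk α.2).symm
  obtain ⟨⟨s, hs⟩, -⟩ := h
  change α.1 = _ at hs
  rw [hs] at h1
  have h2 := rank_mul_le_left (zeta k) s
  rw [← h1, rank_zeta] at h2
  omega

theorem card_pushout (hk : 2 ≤ k) : Nat.card (RightAction.Pushout (iso3 k)) =
    1 + 3 * numProj (2 * k) 4 + 2 * numProj (2 * k) 2 + numProj (2 * k) 0 := by
  have : Finite (Quotient (tau k)) := Quotient.finite _
  rw [Nat.card_congr (RightAction.pushoutEquiv (iso3 k)), Nat.card_sum, card_compl_Rzeta hk,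
    card_Omega2 hk]
  ring

end Brauer

/-- The two actions and the isomorphism of sub-acts are determined by the formulas below; that
they exist is part of the claim. -/
theorem theorem6p9 (k : ℕ) (hk : 2 ≤ k) :
    IsRightCongruence (Brauer.tau k) ∧
    ∃ (μ₁ : RightAction (Brauer.Omega1 k) (Brauer (2 * k)))
      (μ₂ : RightAction (Brauer.Omega2 k) (Brauer (2 * k)))
      (ξ : RightAction.SubActIso μ₁ μ₂ (Brauer.Rzeta k) (Brauer.Omega3 k)),
      (∀ (α : Brauer.Omega1 k) (β : Brauer (2 * k)),
        (μ₁.act α β : Brauer (2 * k)) = (α : Brauer (2 * k)) * β) ∧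
      (∀ (c : Brauer.Omega2 k) (α β : Brauer (2 * k)),
        (c : Quotient (Brauer.tau k)) = Brauer.tauClass k α →
          (μ₂.act c β : Quotient (Brauer.tau k)) = Brauer.tauClass k (α * β)) ∧
      (∀ α : Brauer.Rzeta k,
        ((ξ.toEquiv α : Brauer.Omega2 k) : Quotient (Brauer.tau k)) =
          Brauer.tauClass k ((α : Brauer.Omega1 k) : Brauer (2 * k))) ∧
      (RightAction.pushout ξ).Faithful ∧
      Nat.card (RightAction.Pushout ξ) =
        1 + 3 * Brauer.numProj (2 * k) 4 + 2 * Brauer.numProj (2 * k) 2 +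
          Brauer.numProj (2 * k) 0 ∧
      transDegree (Brauer (2 * k)) ≤
        1 + 3 * Brauer.numProj (2 * k) 4 + 2 * Brauer.numProj (2 * k) 2 +
          Brauer.numProj (2 * k) 0 := by
  -- `Nat.card` is `0` on infinite and on empty types, so the summand `1` yields both finiteness and
  -- nonemptiness.
  have : Finite (RightAction.Pushout (Brauer.iso3 k)) :=
    Nat.finite_of_card_ne_zero (by rw [Brauer.card_pushout hk]; omega)
  have : Nonempty (RightAction.Pushout (Brauer.iso3 k)) :=
    ((Nat.card_ne_zero (α := RightAction.Pushout (Brauer.iso3 k))).1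
      (by rw [Brauer.card_pushout hk]; omega)).1
  refine ⟨Brauer.isRightCongruence_tau, Brauer.act1 k, Brauer.act2 k, Brauer.iso3 k,
    fun _ _ => rfl, fun c α β h => Brauer.act2_tauClass h β, fun _ => rfl,
    Brauer.pushout_faithful hk, Brauer.card_pushout hk, ?_⟩
  rw [← Brauer.card_pushout hk]
  exact transDegree_le _ (Brauer.pushout_faithful hk)
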